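/- **Theorem 2.1.** Let $N\ge 1$ be an integer, $p,q>1$, $\mu_1,\mu_2>0$, $R>0$. For real $n$ put $$\Lambda(n,p,q)=\frac{p+1}{pq-1}-\frac{n-1}{2},\qquad \Omega=\max\big(\Lambda(N+\mu_1,p,q),\,\Lambda(N+\mu_2,q,p)\big),$$ and assume $\Omega\ge 0$. Let $f_1,f_2\in H^1(\mathbb R^N)$ and $g_1,g_2\in L^2(\mathbb R^N)$ be non-negative functions supported in the ball $\{|x|\le R\}$ such that, for each $i=1,2$, the pair $(f_i,g_i)$ is not identically zero (i.e. $f_i$ and $g_i$ do not both vanish almost everywhere). Consider $$\begin{cases}u_{tt}-\Delta u+\frac{\mu_1}{1+t}u_t=|v_t|^p,\\ v_{tt}-\Delta v+\frac{\mu_2}{1+t}v_t=|u_t|^q,\\ (u,u_t,v,v_t)(0)=(\varepsilon f_1,\varepsilon g_1,\varepsilon f_2,\varepsilon g_2).\end{cases}\tag{1}$$ For $0<T\le\infty$, an energy solution of (1) on $[0,T)$ is a pair $u,v\in C([0,T),H^1(\mathbb R^N))\cap C^1([0,T),L^2(\mathbb R^N))$ with the initial values in (1), with $u_t\in L^q_{loc}((0,T)\times\mathbb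 R^N)$ and $v_t\in L^p_{loc}((0,T)\times\mathbb R^N)$, such that for every $\Phi\in C_0^\infty(\mathbb R^N\times[0,T))$ and every $t\in[0,T)$ $$\int u_t(x,t)\Phi(x,t)\,dx-\int u_t(x,0)\Phi(x,0)\,dx-\int_0^t\!\!\int u_t\Phi_t\,dx\,ds+\int_0^t\!\!\int\nabla u\cdot\nabla\Phi\,dx\,ds+\int_0^t\!\!\int\frac{\mu_1}{1+s}u_t\Phi\,dx\,ds=\int_0^t\!\!\int|v_t|^p\Phi\,dx\,ds,$$ where the integral on the right converges absolutely, and likewise with $(u,v,\mu_1,p)$ replaced by $(v,u,\mu_2,q)$. Then there are constants $\varepsilon_0>0$ and $C>0$, depending only on $f_1,f_2,g_1,g_2,N,R,p,q,\mu_1,\mu_2$, such that for every $0<\varepsilon\le\varepsilon_0$ and every energy solution $(u,v)$ of (1) on an interval $[0,T)$, $0<T\le\infty$, with $\operatorname{supp}u,\operatorname{supp}v\subset\{|x|\le t+R\}$, one has $T<\infty$ and - $T\le C\varepsilon^{-1/\Omega}$ if $\Omega>0$; - $T\le\exp\big(C\varepsilon^{-(pq-1)}\big)$ if $\Omega=0$;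 - $T\le\exp\big(C\varepsilon^{-\min\left(\frac{pq-1}{p+1},\frac{pq-1}{q+1}\right)}\big)$ if $\Lambda(N+\mu_1,p,q)=\Lambda(N+\mu_2,q,p)=0$. -/

import Mathlib

open MeasureTheory Set
open scoped ContDiff

/-- The Euclidean space `ℝ^N`. -/
abbrev Space (N : ℕ) : Type := EuclideanSpace ℝ (Fin N)

/-- `L²(ℝ^N)`. -/
abbrev L2 (N : ℕ) : Type := Lp ℝ 2 (volume : Measure (Space N))

/-- `L²(ℝ^N; ℝ^N)`, the space in which gradients live. -/
abbrev L2Vec (N : ℕ) : Type := Lp (Space N) 2 (volume : Measure (Space N))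

/-- `G` is the weak (distributional) gradient of `w`. -/
def IsWeakGradient {N : ℕ} (w : L2 N) (G : L2Vec N) : Prop :=
  ∀ φ : Space N → ℝ, ContDiff ℝ ∞ φ → HasCompactSupport φ → ∀ i : Fin N,
    ∫ x, w x * fderiv ℝ φ x (EuclideanSpace.single i 1) = - ∫ x, G x i * φ x

/-- `w` belongs to the Sobolev space `H¹(ℝ^N)`. -/
def MemH1 {N : ℕ} (w : L2 N) : Prop := ∃ G : L2Vec N, IsWeakGradient w G

/-- The real time interval `[0, T)`, where `T = ∞` is allowed. -/
def timeInterval (T : EReal) : Set ℝ := {t : ℝ | 0 ≤ t ∧ (t : EReal) < T}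

/-- `u ∈ C([0,T), H¹) ∩ C¹([0,T), L²)`, with time derivative `ut` and spatial weak gradient `Du`.
Since `‖w‖²_{H¹} = ‖w‖²_{L²} + ‖∇w‖²_{L²}`, continuity in `H¹` is continuity in `L²` of both `u`
and `Du`. -/
structure IsEnergyCurve {N : ℕ} (T : EReal) (u ut : ℝ → L2 N) (Du : ℝ → L2Vec N) : Prop where
  continuousOn : ContinuousOn u (timeInterval T)
  weakGradient : ∀ t ∈ timeInterval T, IsWeakGradient (u t) (Du t)
  continuousOn_grad : ContinuousOn Du (timeInterval T)
  hasDeriv : ∀ t ∈ timeInterval T, HasDerivWithinAt u (ut t) (timeInterval T) t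
  continuousOn_deriv : ContinuousOn ut (timeInterval T)

/-- `w ∈ L^r_loc((0,T) × ℝ^N)`, for a continuous curve `w` in `L²`: finiteness of the integral of
`|w|^r` over all compact boxes in `(0,T) × ℝ^N`. -/
def IsLocallyLr {N : ℕ} (T : EReal) (r : ℝ) (w : ℝ → L2 N) : Prop :=
  ∀ a b ρ : ℝ, 0 < a → (b : EReal) < T →
    ∫⁻ s in Icc a b, ∫⁻ x in Metric.closedBall (0 : Space N) ρ, ‖w s x‖ₑ ^ r < ⊤

/-- `Φ ∈ C_0^∞(ℝ^N × [0,T))`: smooth up to `t = 0`, with compact support that may meet `t = 0` but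
stays away from `t = T`. Such functions are given through an extension to negative times. -/
structure IsTestFunction {N : ℕ} (T : EReal) (Φ : ℝ → Space N → ℝ) : Prop where
  smooth : ContDiff ℝ ∞ (fun z : ℝ × Space N => Φ z.1 z.2)
  compactSupport : HasCompactSupport (fun z : ℝ × Space N => Φ z.1 z.2)
  support_lt : ∀ z ∈ tsupport (fun z : ℝ × Space N => Φ z.1 z.2), (z.1 : EReal) < T

/-- The weak form on `[0,T)` of `u_tt - Δu + μ/(1+t) u_t = |w|^r`, in terms of `ut = u_t` and
`Du = ∇u`. The first conjunct says that the integral on the right-hand side converges absolutely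
(otherwise the Bochner integral would silently be zero); the linear terms always converge. -/
def SatisfiesWeakForm {N : ℕ} (T : EReal) (μ r : ℝ) (ut : ℝ → L2 N) (Du : ℝ → L2Vec N)
    (w : ℝ → L2 N) : Prop :=
  ∀ Φ : ℝ → Space N → ℝ, IsTestFunction T Φ → ∀ t ∈ timeInterval T,
    (∫⁻ s in Ioc 0 t, ∫⁻ x, ‖w s x‖ₑ ^ r * ‖Φ s x‖ₑ < ⊤) ∧
    (∫ x, ut t x * Φ t x) - (∫ x, ut 0 x * Φ 0 x)
      - (∫ s in (0 : ℝ)..t, ∫ x, ut s x * deriv (fun τ => Φ τ x) s)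
      + (∫ s in (0 : ℝ)..t, ∫ x, inner ℝ (Du s x) (gradient (Φ s) x))
      + (∫ s in (0 : ℝ)..t, ∫ x, μ / (1 + s) * ut s x * Φ s x)
      = ∫ s in (0 : ℝ)..t, ∫ x, |w s x| ^ r * Φ s x

/-- `(u, v)` is an energy solution on `[0,T)` of
`u_tt - Δu + μ₁/(1+t) u_t = |v_t|^p`, `v_tt - Δv + μ₂/(1+t) v_t = |u_t|^q`
with initial data `(u, u_t, v, v_t)(0) = (u₀, u₁, v₀, v₁)`. -/
def IsEnergySolution {N : ℕ} (μ₁ μ₂ p q : ℝ) (u₀ u₁ v₀ v₁ : L2 N) (T : EReal)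
    (u v : ℝ → L2 N) : Prop :=
  0 < T ∧ ∃ (ut vt : ℝ → L2 N) (Du Dv : ℝ → L2Vec N),
    IsEnergyCurve T u ut Du ∧ IsEnergyCurve T v vt Dv ∧
    IsLocallyLr T q ut ∧ IsLocallyLr T p vt ∧
    u 0 = u₀ ∧ ut 0 = u₁ ∧ v 0 = v₀ ∧ vt 0 = v₁ ∧
    SatisfiesWeakForm T μ₁ p ut Du vt ∧ SatisfiesWeakForm T μ₂ q vt Dv ut

/-- `w` vanishes (almost everywhere) outside the closed ball of radius `R` about the origin. -/
def SupportedInBall {N : ℕ} (R : ℝ) (w : L2 N) : Prop :=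
  ∀ᵐ x : Space N, R < ‖x‖ → w x = 0

/-- The support of `u` is contained in the cone `|x| ≤ t + R`. -/
def SupportedInCone {N : ℕ} (T : EReal) (R : ℝ) (u : ℝ → L2 N) : Prop :=
  ∀ t ∈ timeInterval T, SupportedInBall (t + R) (u t)

/-- `Λ(n,p,q) = (p+1)/(pq-1) - (n-1)/2`, for a real "dimension" `n`. -/
noncomputable def Lam (n p q : ℝ) : ℝ := (p + 1) / (p * q - 1) - (n - 1) / 2

/-- `Ω(N,μ₁,μ₂,p,q) = max (Λ(N+μ₁,p,q), Λ(N+μ₂,q,p))`. -/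
noncomputable def Omeg (N : ℕ) (μ₁ μ₂ p q : ℝ) : ℝ :=
  max (Lam (N + μ₁) p q) (Lam (N + μ₂) q p)

/-!
The idea is to pair the system with `e^{-t} (1+t)^{μ/2} φ(x)`, where `φ` is the positive radial
solution of `Δφ = φ`, an almost exact solution of the adjoint of the damped wave equation, and to
derive a system of ordinary differential inequalities that blows up.

* `φ` is `radialExp`, a power series in `|x|²`. A Riccati argument in the radial variable
  (`radial_solution_le`) gives `φ(x) ≤ C (1+|x|)^{-(N-1)/2} e^{|x|}`, hence
  `∫_{|x| ≤ r} φ ≤ C (1+r)^{(N-1)/2} e^r` (`integral_radialExp_le`).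

* Finite propagation speed makes the cut-off test functions `a(t) φ(x)` admissible, and the weak
  form becomes the equation `W'' + μ/(1+t) W' = W + S` for `W = ∫ u φ`, with the source
  `S = ∫ |v_t|^p φ ≥ 0`, tested against arbitrary smooth weights `a` (`isDampedMode_of_weakForm`).

* For this equation `W ≥ 0` (`IsDampedMode.nonneg`), `W' ≥ r₀ W` for a Riccati subsolution `r₀`
  (`IsDampedMode.deriv_ge`), and `e^{-t} (1+t)^{μ/2} (W' + γ W)` dominates the data plus
  `∫₀ᵗ e^{-s} (1+s)^{μ/2} S` for a bounded Riccati supersolution `γ`. Together these bound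
  `e^{-t} (1+t)^{μ/2} W'` from below by a multiple of the data plus the weighted source when `t ≥ 1`
  (`exists_lower_bound_dampedMode`). No special functions in time are needed.

* Hölder's inequality for the measure `φ dx` on `|x| ≤ t + R + 1` bounds the source of one equation
  by the mode `∫ v_t φ` of the other. The exponentials cancel, and the two lower bounds `G`, `H`
  satisfy `G' ≥ c t^{a - pb} H^p` and `H' ≥ c t^{b - qa} G^q` with `a = (N - 1 + μ₁)/2`,
  `b = (N - 1 + μ₂)/2` (`exists_isBlowupPair`).

* Eliminating `H` gives `G(s + 2h) ≥ G(s) + c h^{p+1} s^{-(p+1)+(pq-1)Λ} G(s)^{pq}` with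
  `Λ = Λ(N+μ₁, p, q)`. Once `s^Λ G(s)` exceeds a constant, `G` blows up before `2s`
  (`lifespan_le_two_mul_of_large`). For `Λ > 0` the bound `G ≥ d ε` suffices to reach this
  threshold. For `Λ = 0` the function `G` must first grow to a constant, and the times needed for
  its successive doublings on the logarithmic scale form a geometric series dominated by the first
  term, a power of `1/ε` (`lifespan_le_exp_of_doubling`).
-/

open Filter Topology

/-! ### The radial profile -/

/-- Coefficients of the entire function `₀F₁(; ν; s / 4)`. -/
noncomputable def besselCoeff (ν : ℝ) (k : ℕ) : ℝ :=
  (4 ^ k * (k.factorial : ℝ) * ∏ j ∈ Finset.range k, (ν + j))⁻¹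

/-- The entire function `₀F₁(; ν; s / 4) = ∑ sᵏ / (4ᵏ k! ν (ν + 1) ⋯ (ν + k - 1))`. With `s = r²` it
is, up to a power of `r`, the modified Bessel function of the first kind of order `ν - 1`. -/
noncomputable def besselSeries (ν s : ℝ) : ℝ := ∑' k : ℕ, besselCoeff ν k * s ^ k

lemma besselCoeff_pos {ν : ℝ} (hν : 0 < ν) (k : ℕ) : 0 < besselCoeff ν k := by
  unfold besselCoeff
  have : 0 < ∏ j ∈ Finset.range k, (ν + j) := Finset.prod_pos fun j _ => by positivity
  positivity

lemma besselCoeff_le {ν : ℝ} (hν : 1 / 2 ≤ ν) (k : ℕ) :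
    besselCoeff ν k ≤ ((k.factorial : ℝ))⁻¹ := by
  unfold besselCoeff
  apply inv_anti₀ (by positivity)
  have h1 : (1 / 2 : ℝ) ^ k ≤ ∏ j ∈ Finset.range k, (ν + j) := by
    have := Finset.prod_le_prod (s := Finset.range k) (f := fun _ => (1 / 2 : ℝ))
      (g := fun j : ℕ => ν + (j : ℝ)) (fun _ _ => by norm_num)
      (fun j _ => by have : (0 : ℝ) ≤ j := j.cast_nonneg; linarith)
    simpa using this
  have h2 : (1 : ℝ) ≤ 4 ^ k * (1 / 2) ^ k := by
    rw [← mul_pow]; exact one_le_pow₀ (by norm_num)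
  have h3 : (0 : ℝ) < k.factorial := by positivity
  have h4 : (1 : ℝ) ≤ 4 ^ k * ∏ j ∈ Finset.range k, (ν + j) :=
    h2.trans (mul_le_mul_of_nonneg_left h1 (by positivity))
  nlinarith

lemma besselCoeff_succ_mul {ν : ℝ} (hν : 0 < ν) (k : ℕ) :
    besselCoeff ν (k + 1) * ((k : ℝ) + 1) = besselCoeff (ν + 1) k / (4 * ν) := by
  unfold besselCoeff
  rw [Finset.prod_range_succ', Nat.factorial_succ, pow_succ]
  have h0 : ∀ j ∈ Finset.range k, (ν + ((j + 1 : ℕ) : ℝ)) = ν + 1 + j := by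
    intro j _; push_cast; ring
  rw [Finset.prod_congr rfl h0]
  have : 0 < ∏ j ∈ Finset.range k, (ν + 1 + j) := Finset.prod_pos fun j _ => by positivity
  push_cast
  field_simp
  simp

lemma besselCoeff_succ {ν : ℝ} (hν : 0 < ν) (k : ℕ) :
    besselCoeff ν (k + 1) * (4 * ((k : ℝ) + 1) * (ν + k)) = besselCoeff ν k := by
  unfold besselCoeff
  rw [Finset.prod_range_succ, Nat.factorial_succ, pow_succ]
  have : 0 < ∏ j ∈ Finset.range k, (ν + j) := Finset.prod_pos fun j _ => by positivity
  push_cast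
  field_simp

lemma besselSeries_summable {ν : ℝ} (hν : 1 / 2 ≤ ν) (s : ℝ) :
    Summable fun k => besselCoeff ν k * s ^ k := by
  refine Summable.of_norm_bounded (Real.summable_pow_div_factorial |s|) fun k => ?_
  rw [norm_mul, norm_pow, Real.norm_eq_abs, Real.norm_eq_abs,
    abs_of_pos (besselCoeff_pos (by linarith) k), div_eq_inv_mul]
  exact mul_le_mul_of_nonneg_right (besselCoeff_le hν k) (by positivity)

lemma besselSeries_pos {ν s : ℝ} (hν : 1 / 2 ≤ ν) (hs : 0 ≤ s) : 0 < besselSeries ν s := by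
  have h : ∀ k, 0 ≤ besselCoeff ν k * s ^ k := fun k =>
    mul_nonneg (besselCoeff_pos (by linarith) k).le (by positivity)
  refine (besselSeries_summable hν s).tsum_pos h 0 ?_
  simpa using besselCoeff_pos (by linarith) 0

lemma hasDerivAt_besselSeries {ν : ℝ} (hν : 1 / 2 ≤ ν) (s : ℝ) :
    HasDerivAt (besselSeries ν) (besselSeries (ν + 1) s / (4 * ν)) s := by
  have hν0 : 0 < ν := by linarith
  set r : ℝ := |s| + 1 with hr
  have hsum : Summable fun k : ℕ => besselCoeff ν k * (k * r ^ (k - 1)) := by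
    rw [← summable_nat_add_iff 1]
    have := (besselSeries_summable (ν := ν + 1) (by linarith) r).div_const (4 * ν)
    refine this.congr fun k => ?_
    have := besselCoeff_succ_mul hν0 k
    rw [mul_div_right_comm, ← this]
    push_cast
    ring
  have h := hasDerivAt_tsum_of_isPreconnected hsum (t := Metric.ball (0 : ℝ) r)
    (g := fun k s => besselCoeff ν k * s ^ k) (g' := fun k s => besselCoeff ν k * (k * s ^ (k - 1)))
    (y₀ := 0) (y := s) Metric.isOpen_ball (convex_ball _ _).isPreconnected
    (fun k y _ => (hasDerivAt_pow k y).const_mul _) ?_ (by simp; positivity)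
    (besselSeries_summable hν 0) (by simp [hr])
  · have e : ∑' k : ℕ, besselCoeff ν k * (k * s ^ (k - 1)) = besselSeries (ν + 1) s / (4 * ν) := by
      have hs2 : Summable fun k : ℕ => besselCoeff ν k * (k * s ^ (k - 1)) := by
        refine Summable.of_norm_bounded hsum fun k => ?_
        rw [norm_mul, norm_mul, norm_pow, Real.norm_eq_abs, Real.norm_eq_abs, Real.norm_eq_abs,
          abs_of_pos (besselCoeff_pos hν0 k), Nat.abs_cast]
        have := (besselCoeff_pos hν0 k).le
        gcongr
        linarith
      rw [hs2.tsum_eq_zero_add, besselSeries, ← tsum_div_const]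
      simp only [Nat.cast_zero, zero_mul, mul_zero, zero_add]
      refine tsum_congr fun k => ?_
      have := besselCoeff_succ_mul hν0 k
      rw [mul_div_right_comm, ← this]
      push_cast
      ring
    rw [e] at h
    exact h
  · intro k y hy
    rw [Metric.mem_ball, dist_zero_right, Real.norm_eq_abs] at hy
    rw [norm_mul, norm_mul, norm_pow, Real.norm_eq_abs, Real.norm_eq_abs, Real.norm_eq_abs,
      abs_of_pos (besselCoeff_pos hν0 k), Nat.abs_cast]
    have := (besselCoeff_pos hν0 k).le
    gcongr

lemma contDiff_besselSeries {ν : ℝ} (hν : 1 / 2 ≤ ν) : ContDiff ℝ ∞ (besselSeries ν) := by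
  rw [contDiff_infty]
  intro n
  induction n generalizing ν with
  | zero =>
    exact contDiff_zero.2 (continuous_iff_continuousAt.2 fun s =>
      (hasDerivAt_besselSeries hν s).continuousAt)
  | succ n ih =>
    push_cast
    rw [contDiff_succ_iff_deriv]
    refine ⟨fun s => (hasDerivAt_besselSeries hν s).differentiableAt, by simp, ?_⟩
    have : deriv (besselSeries ν) = fun s => besselSeries (ν + 1) s / (4 * ν) :=
      funext fun s => (hasDerivAt_besselSeries hν s).deriv
    rw [this]
    exact (ih (by linarith)).div_const _

/-- The contiguity relation, equivalent to the equation `4 s F'' + 4 ν F' = F`. -/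
lemma besselSeries_eq {ν : ℝ} (hν : 1 / 2 ≤ ν) (s : ℝ) :
    besselSeries ν s =
      besselSeries (ν + 1) s + s * besselSeries (ν + 2) s / (4 * ν * (ν + 1)) := by
  have hν0 : 0 < ν := by linarith
  have h1 := besselSeries_summable hν s
  have h2 := besselSeries_summable (ν := ν + 1) (by linarith) s
  have h3 := besselSeries_summable (ν := ν + 2) (by linarith) s
  have e : s * besselSeries (ν + 2) s / (4 * ν * (ν + 1))
      = ∑' k, s * (besselCoeff (ν + 2) k * s ^ k) / (4 * ν * (ν + 1)) := by
    rw [tsum_div_const, tsum_mul_left]; rfl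
  rw [e, besselSeries, besselSeries, h1.tsum_eq_zero_add, h2.tsum_eq_zero_add, add_assoc,
    ← Summable.tsum_add ((summable_nat_add_iff 1).2 h2) ((h3.mul_left s).div_const _)]
  refine congrArg₂ (· + ·) (by simp [besselCoeff]) ?_
  refine tsum_congr fun k => ?_
  have a1 := besselCoeff_succ_mul hν0 k
  have a2 := besselCoeff_succ_mul (ν := ν + 1) (by linarith) k
  have a3 := besselCoeff_succ (ν := ν + 1) (by linarith) k
  rw [show ν + 1 + 1 = ν + 2 by ring] at a2
  have b2 : besselCoeff (ν + 2) k = besselCoeff (ν + 1) (k + 1) * (k + 1) * (4 * (ν + 1)) := by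
    rw [a2]; field_simp
  have b1 : besselCoeff ν (k + 1) = besselCoeff (ν + 1) (k + 1) * (ν + 1 + k) / ν := by
    have : (0 : ℝ) < k + 1 := by positivity
    rw [← a3] at a1
    field_simp at a1 ⊢
    linarith
  rw [b2, b1, pow_succ]
  field_simp
  ring

/-- Upper bound for nonnegative nondecreasing solutions of the radial equation
`g'' + (2m/r) g' = g`, by monotonicity of `ρ (g' + γ g)` with
`γ = 1 + m/r + m²/r²` and `ρ'/ρ = 2m/r - γ`. -/
lemma radial_solution_le {m : ℝ} (hm : 0 ≤ m) {g g' : ℝ → ℝ}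
    (hg : ∀ r, 1 ≤ r → HasDerivAt g (g' r) r)
    (hg' : ∀ r, 1 ≤ r → HasDerivAt g' (g r - 2 * m / r * g' r) r)
    (h0 : ∀ r, 1 ≤ r → 0 ≤ g r) (h0' : ∀ r, 1 ≤ r → 0 ≤ g' r) :
    ∃ C : ℝ, 0 ≤ C ∧ ∀ r, 1 ≤ r → g r ≤ C * (Real.exp r * r ^ (-m)) := by
  set Z : ℝ → ℝ := fun r => Real.exp (-r + m * Real.log r + m ^ 2 * r⁻¹) *
    (g' r + (1 + m * r⁻¹ + m ^ 2 * r⁻¹ ^ 2) * g r) with hZ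
  have hder : ∀ r, 1 ≤ r → HasDerivAt Z (-(Real.exp (-r + m * Real.log r + m ^ 2 * r⁻¹) *
      ((m ^ 2 * r⁻¹ ^ 2 + m ^ 4 * r⁻¹ ^ 4 + m * r⁻¹ ^ 2 + 2 * m ^ 2 * r⁻¹ ^ 3) * g r))) r := by
    intro r hr
    have hr0 : r ≠ 0 := by positivity
    have d1 : HasDerivAt (fun r : ℝ => r⁻¹) (-(r⁻¹ ^ 2)) r := by
      simpa using hasDerivAt_inv hr0
    have d2 := (((hasDerivAt_id r).neg.add ((Real.hasDerivAt_log hr0).const_mul m)).add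
      (d1.const_mul (m ^ 2))).exp
    have d3 := (hg' r hr).add ((((d1.const_mul m).const_add 1).add
      ((d1.pow 2).const_mul (m ^ 2))).mul (hg r hr))
    refine (d2.mul d3).congr_deriv ?_
    simp only [id, Pi.add_apply, Pi.neg_apply, Pi.mul_apply, Pi.pow_apply]
    rw [div_eq_mul_inv]
    push_cast
    ring
  have hanti : AntitoneOn Z (Ici 1) := by
    refine antitoneOn_of_deriv_nonpos (convex_Ici 1)
      (fun r hr => (hder r hr).continuousAt.continuousWithinAt)
      (fun r hr => ?_) ?_
    · rw [interior_Ici] at hr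
      exact (hder r hr.le).differentiableAt.differentiableWithinAt
    intro r hr
    rw [interior_Ici] at hr
    have hr1 : 1 ≤ r := hr.le
    have hr0 : 0 < r := by linarith
    rw [(hder r hr1).deriv, neg_nonpos]
    have := h0 r hr1
    positivity
  refine ⟨|Z 1|, abs_nonneg _, fun r hr => ?_⟩
  have hr0 : 0 < r := by linarith
  have h1 : Z r ≤ |Z 1| := (hanti (mem_Ici.2 le_rfl) hr hr).trans (le_abs_self _)
  have h2 : Real.exp (-r + m * Real.log r) * g r ≤ Z r := by
    have a1 := h0 r hr
    have a2 := h0' r hr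
    have a3 : Real.exp (-r + m * Real.log r) ≤ Real.exp (-r + m * Real.log r + m ^ 2 * r⁻¹) :=
      Real.exp_le_exp.2 (by have : 0 ≤ m ^ 2 * r⁻¹ := by positivity
                            linarith)
    have a4 : g r ≤ g' r + (1 + m * r⁻¹ + m ^ 2 * r⁻¹ ^ 2) * g r := by
      have : 0 ≤ (m * r⁻¹ + m ^ 2 * r⁻¹ ^ 2) * g r := by positivity
      linarith
    exact mul_le_mul a3 a4 a1 (Real.exp_pos _).le
  have h3 : Real.exp r * r ^ (-m) * Real.exp (-r + m * Real.log r) = 1 := by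
    rw [Real.rpow_def_of_pos hr0, ← Real.exp_add, ← Real.exp_add]
    ring_nf; exact Real.exp_zero
  calc g r = Real.exp r * r ^ (-m) * Real.exp (-r + m * Real.log r) * g r := by rw [h3, one_mul]
    _ = (Real.exp r * r ^ (-m)) * (Real.exp (-r + m * Real.log r) * g r) := by ring
    _ ≤ (Real.exp r * r ^ (-m)) * |Z 1| := by gcongr; exact h2.trans h1
    _ = _ := by ring

lemma besselSeries_sq_le {ν : ℝ} (hν : 1 / 2 ≤ ν) :
    ∃ C : ℝ, 0 < C ∧ ∀ r : ℝ, 0 ≤ r →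
      besselSeries ν (r ^ 2) ≤ C * (Real.exp r * (1 + r) ^ (-(ν - 1 / 2))) := by
  set m : ℝ := ν - 1 / 2 with hm
  have hm0 : 0 ≤ m := by linarith
  have hcont : Continuous (besselSeries ν) := (contDiff_besselSeries hν).continuous
  have hsq : ∀ r : ℝ, HasDerivAt (fun r : ℝ => r ^ 2) (2 * r) r := fun r => by
    simpa using hasDerivAt_pow 2 r
  obtain ⟨C₁, hC₁, h1⟩ := radial_solution_le hm0 (g := fun r => besselSeries ν (r ^ 2))
    (g' := fun r => besselSeries (ν + 1) (r ^ 2) / (4 * ν) * (2 * r))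
    (fun r _ => by
      exact (hasDerivAt_besselSeries hν (r ^ 2)).comp r (hsq r))
    (fun r hr => by
      have d := (((hasDerivAt_besselSeries (ν := ν + 1) (by linarith) (r ^ 2)).comp r
        (hsq r)).div_const (4 * ν)).mul ((hasDerivAt_id r).const_mul 2)
      refine d.congr_deriv ?_
      have e := besselSeries_eq hν (r ^ 2)
      have hr0 : r ≠ 0 := by positivity
      have hν0 : ν ≠ 0 := by positivity
      have hν1 : ν + 1 ≠ 0 := by positivity
      simp only [id, Function.comp]
      rw [e, show ν + 1 + 1 = ν + 2 by ring, hm]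
      field_simp
      ring)
    (fun r _ => (besselSeries_pos hν (by positivity)).le)
    (fun r hr => by
      have := (besselSeries_pos (ν := ν + 1) (by linarith) (sq_nonneg r)).le
      positivity)
  obtain ⟨C₂, hC₂⟩ := (isCompact_Icc (a := (0 : ℝ)) (b := 1)).exists_bound_of_continuousOn
    (f := fun r => besselSeries ν (r ^ 2)) (by fun_prop)
  have hC₂0 : 0 ≤ C₂ := (norm_nonneg _).trans (hC₂ 0 (by simp))
  refine ⟨2 ^ m * (C₁ + C₂ + 1), by positivity, fun r hr => ?_⟩
  have h2m : (2 : ℝ) ^ m * 2 ^ (-m) = 1 := by rw [← Real.rpow_add (by norm_num)]; simp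
  rcases le_total r 1 with h | h
  · have a1 := (le_abs_self _).trans (hC₂ r ⟨hr, h⟩)
    have a2 : (2 : ℝ) ^ (-m) ≤ (1 + r) ^ (-m) :=
      Real.rpow_le_rpow_of_nonpos (by linarith) (by linarith) (by linarith)
    have a3 : 1 ≤ Real.exp r := Real.one_le_exp hr
    calc besselSeries ν (r ^ 2) ≤ (C₁ + C₂ + 1) * (1 * (2 ^ m * 2 ^ (-m))) := by
          rw [h2m]; linarith
      _ ≤ (C₁ + C₂ + 1) * (Real.exp r * (2 ^ m * (1 + r) ^ (-m))) := by gcongr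
      _ = _ := by ring
  · have hr0 : 0 < r := by linarith
    have a2 : r ^ (-m) ≤ 2 ^ m * (1 + r) ^ (-m) := by
      have : (2 * r) ^ (-m) ≤ (1 + r) ^ (-m) :=
        Real.rpow_le_rpow_of_nonpos (by linarith) (by linarith) (by linarith)
      rw [Real.mul_rpow (by norm_num) hr0.le] at this
      calc r ^ (-m) = 2 ^ m * 2 ^ (-m) * r ^ (-m) := by rw [h2m, one_mul]
        _ = 2 ^ m * (2 ^ (-m) * r ^ (-m)) := by ring
        _ ≤ _ := by gcongr
    calc besselSeries ν (r ^ 2) ≤ C₁ * (Real.exp r * r ^ (-m)) := h1 r h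
      _ ≤ (C₁ + C₂ + 1) * (Real.exp r * (2 ^ m * (1 + r) ^ (-m))) := by
          gcongr; linarith
      _ = _ := by ring

/-! ### The positive solution of `Δφ = φ` -/

/-- The positive radial solution of `Δφ = φ` on `ℝ^N`: up to a constant factor it is the average of
`x ↦ exp (x · ω)` over the unit vectors `ω`. -/
noncomputable def radialExp (N : ℕ) (x : Space N) : ℝ := besselSeries (N / 2) (‖x‖ ^ 2)

section RadialExp

variable {N : ℕ}

lemma half_le_half_natCast (hN : 1 ≤ N) : (1 / 2 : ℝ) ≤ N / 2 := by
  have : (1 : ℝ) ≤ N := by exact_mod_cast hN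
  linarith

lemma contDiff_radialExp (hN : 1 ≤ N) : ContDiff ℝ ∞ (radialExp N) :=
  (contDiff_besselSeries (half_le_half_natCast hN)).comp (contDiff_norm_sq ℝ)

lemma radialExp_pos (hN : 1 ≤ N) (x : Space N) : 0 < radialExp N x :=
  besselSeries_pos (half_le_half_natCast hN) (by positivity)

lemma hasFDerivAt_comp_norm_sq {F : ℝ → ℝ} {F' : ℝ} (x : Space N)
    (h : HasDerivAt F F' (‖x‖ ^ 2)) :
    HasFDerivAt (fun y : Space N => F (‖y‖ ^ 2)) (F' • (2 • innerSL ℝ x)) x := by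
  exact h.comp_hasFDerivAt x (hasStrictFDerivAt_norm_sq x).hasFDerivAt

lemma fderiv_radialExp (hN : 1 ≤ N) (x : Space N) (i : Fin N) :
    fderiv ℝ (radialExp N) x (EuclideanSpace.single i 1)
      = besselSeries (N / 2 + 1) (‖x‖ ^ 2) / (4 * (N / 2)) * (2 * x i) := by
  have h := hasFDerivAt_comp_norm_sq x
    (hasDerivAt_besselSeries (half_le_half_natCast hN) (‖x‖ ^ 2))
  rw [show radialExp N = fun y : Space N => besselSeries (N / 2) (‖y‖ ^ 2) from rfl, h.fderiv]
  simp [EuclideanSpace.inner_single_right]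

lemma laplacian_radialExp (hN : 1 ≤ N) (x : Space N) :
    ∑ i : Fin N, fderiv ℝ (fun y => fderiv ℝ (radialExp N) y (EuclideanSpace.single i 1)) x
      (EuclideanSpace.single i 1) = radialExp N x := by
  have hN2 := half_le_half_natCast hN
  have hN0 : (N : ℝ) ≠ 0 := by positivity
  have hN1 : (N : ℝ) + 2 ≠ 0 := by positivity
  have key : ∀ i : Fin N, fderiv ℝ (fun y => fderiv ℝ (radialExp N) y (EuclideanSpace.single i 1)) x
      (EuclideanSpace.single i 1) = besselSeries (N / 2 + 1) (‖x‖ ^ 2) / N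
        + x i ^ 2 * (besselSeries (N / 2 + 2) (‖x‖ ^ 2) / (2 * N * (N / 2 + 1))) := by
    intro i
    rw [show (fun y => fderiv ℝ (radialExp N) y (EuclideanSpace.single i 1)) = fun y : Space N =>
      besselSeries (N / 2 + 1) (‖y‖ ^ 2) * (EuclideanSpace.proj i y / N) from
      funext fun y => by rw [fderiv_radialExp hN]; simp; field_simp; ring]
    have h1 := hasFDerivAt_comp_norm_sq x
      (hasDerivAt_besselSeries (ν := N / 2 + 1) (by linarith) (‖x‖ ^ 2))
    have h2 : HasFDerivAt (fun y : Space N => EuclideanSpace.proj i y / (N : ℝ))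
        ((N : ℝ)⁻¹ • (EuclideanSpace.proj i : Space N →L[ℝ] ℝ)) x := by
      simp only [div_eq_inv_mul]
      exact (EuclideanSpace.proj i : Space N →L[ℝ] ℝ).hasFDerivAt.const_mul _
    have h3 := (h1.mul h2).fderiv
    simp only [Pi.mul_def] at h3
    rw [h3]
    simp [EuclideanSpace.inner_single_right]
    rw [show (N : ℝ) / 2 + 1 + 1 = N / 2 + 2 by ring]
    field_simp
    ring
  rw [Finset.sum_congr rfl fun i _ => key i, Finset.sum_add_distrib, ← Finset.sum_mul,
    ← EuclideanSpace.real_norm_sq_eq, radialExp, besselSeries_eq hN2]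
  simp
  field_simp
  ring

/-- The exponential growth of `φ` combines with its decay factor `|x|^{-(N-1)/2}`. -/
lemma integral_radialExp_le (hN : 1 ≤ N) : ∃ C : ℝ, 0 < C ∧ ∀ r : ℝ, 0 ≤ r →
    ∫ x in Metric.closedBall (0 : Space N) r, radialExp N x
      ≤ C * ((1 + r) ^ (((N : ℝ) - 1) / 2) * Real.exp r) := by
  obtain ⟨C, hC, hb⟩ := besselSeries_sq_le (half_le_half_natCast hN)
  have hdim : Module.finrank ℝ (Space N) = N := by simp
  have : Nonempty (Fin N) := ⟨⟨0, by omega⟩⟩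
  have : Nontrivial (Space N) := inferInstance
  set m : ℝ := ((N : ℝ) - 1) / 2 with hm
  have hm0 : 0 ≤ m := by have := half_le_half_natCast hN; rw [hm]; linarith
  have hν : (N : ℝ) / 2 - 1 / 2 = m := by rw [hm]; ring
  set b : ℝ := (volume : Measure (Space N)).real (Metric.ball 0 1)
  refine ⟨N * b * C + 1, by positivity, fun r hr => ?_⟩
  have e1 : ∫ x in Metric.closedBall (0 : Space N) r, radialExp N x
      = ∫ x : Space N, (Icc 0 r).indicator (fun s => besselSeries (N / 2) (s ^ 2)) ‖x‖ := by
    rw [← integral_indicator Metric.isClosed_closedBall.measurableSet]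
    congr 1; funext x
    by_cases hx : ‖x‖ ≤ r
    · rw [indicator_of_mem (by simpa using hx),
        indicator_of_mem (mem_Icc.2 ⟨norm_nonneg x, hx⟩), radialExp]
    · rw [indicator_of_notMem (by simpa using hx), indicator_of_notMem fun h => hx h.2]
  rw [e1, integral_fun_norm_addHaar, hdim]
  have e2 : ∫ y in Ioi (0 : ℝ), y ^ (N - 1) •
      (Icc 0 r).indicator (fun s => besselSeries (N / 2) (s ^ 2)) y
      ≤ C * ((1 + r) ^ m * Real.exp r) := by
    have e3 : ∀ y : ℝ, y ^ (N - 1) • (Icc 0 r).indicator (fun s => besselSeries (N / 2) (s ^ 2)) y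
        = (Icc 0 r).indicator (fun y => y ^ (N - 1) * besselSeries (N / 2) (y ^ 2)) y := by
      intro y; simp [indicator_apply]
    simp_rw [e3]
    rw [setIntegral_indicator measurableSet_Icc,
      show Ioi (0 : ℝ) ∩ Icc 0 r = Ioc 0 r by ext y; simp; intro h _; exact h.le,
      ← intervalIntegral.integral_of_le hr]
    have hcont : Continuous (besselSeries ((N : ℝ) / 2)) :=
      (contDiff_besselSeries (half_le_half_natCast hN)).continuous
    calc ∫ y in (0 : ℝ)..r, y ^ (N - 1) * besselSeries (N / 2) (y ^ 2)
        ≤ ∫ y in (0 : ℝ)..r, C * (1 + r) ^ m * Real.exp y := by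
          refine intervalIntegral.integral_mono_on hr
            (Continuous.intervalIntegrable (by fun_prop) _ _)
            (Continuous.intervalIntegrable (by fun_prop) _ _) fun y hy => ?_
          have hy1 : 0 < 1 + y := by linarith [hy.1]
          have a1 := hb y hy.1
          rw [hν] at a1
          have a2 : y ^ (N - 1) ≤ (1 + y) ^ (2 * m) := by
            rw [show 2 * m = ((N - 1 : ℕ) : ℝ) by rw [hm, Nat.cast_sub hN]; push_cast; ring,
              Real.rpow_natCast]
            exact pow_le_pow_left₀ hy.1 (by linarith) _
          have a3 : (1 + y) ^ (2 * m) * (1 + y) ^ (-m) = (1 + y) ^ m := by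
            rw [← Real.rpow_add hy1]; congr 1; ring
          have a4 : (1 + y) ^ m ≤ (1 + r) ^ m :=
            Real.rpow_le_rpow hy1.le (by linarith [hy.2]) hm0
          have hν' := (besselSeries_pos (half_le_half_natCast hN) (sq_nonneg y)).le
          calc y ^ (N - 1) * besselSeries (N / 2) (y ^ 2)
              ≤ (1 + y) ^ (2 * m) * (C * (Real.exp y * (1 + y) ^ (-m))) := by
                gcongr
            _ = C * ((1 + y) ^ (2 * m) * (1 + y) ^ (-m)) * Real.exp y := by ring
            _ ≤ _ := by rw [a3]; gcongr
      _ = C * (1 + r) ^ m * (Real.exp r - 1) := by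
          rw [intervalIntegral.integral_const_mul, integral_exp, Real.exp_zero]
      _ ≤ C * (1 + r) ^ m * Real.exp r := by gcongr; linarith
      _ = _ := by ring
  rw [nsmul_eq_mul, smul_eq_mul]
  calc (N : ℝ) * (b * _) ≤ N * (b * (C * ((1 + r) ^ m * Real.exp r))) := by gcongr
    _ = N * b * C * ((1 + r) ^ m * Real.exp r) := by ring
    _ ≤ _ := by
      have : 0 ≤ (1 + r) ^ m * Real.exp r := by positivity
      nlinarith

end RadialExp

/-! ### Supports, modes, cutoffs and weak gradients -/

section TimeInterval

variable {T : EReal}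

lemma convex_timeInterval : Convex ℝ (timeInterval T) := by
  refine OrdConnected.convex ⟨fun a ha b hb c hc => ⟨ha.1.trans hc.1, ?_⟩⟩
  exact lt_of_le_of_lt (EReal.coe_le_coe_iff.2 hc.2) hb.2

lemma Icc_subset_timeInterval {t : ℝ} (ht : t ∈ timeInterval T) : Icc 0 t ⊆ timeInterval T :=
  fun _ hs => ⟨hs.1, lt_of_le_of_lt (EReal.coe_le_coe_iff.2 hs.2) ht.2⟩

lemma uniqueDiffOn_timeInterval (hT : 0 < T) : UniqueDiffOn ℝ (timeInterval T) := by
  obtain ⟨t, ht0, htT⟩ := EReal.lt_iff_exists_real_btwn.1 hT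
  have ht0' : 0 < t := by exact_mod_cast ht0
  refine uniqueDiffOn_convex convex_timeInterval ⟨t / 2, ?_⟩
  have : Icc 0 t ⊆ timeInterval T := Icc_subset_timeInterval ⟨ht0'.le, htT⟩
  refine interior_mono this ?_
  rw [interior_Icc]
  constructor <;> linarith

end TimeInterval

section Support

variable {N : ℕ}

lemma SupportedInBall.mono {r r' : ℝ} (h : r ≤ r') {w : L2 N} (hw : SupportedInBall r w) :
    SupportedInBall r' w := by
  filter_upwards [hw] with x hx hr
  exact hx (h.trans_lt hr)

/-- The time derivative of a curve supported in the cone `|x| ≤ t + R` is supported in a slightly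
larger cone. -/
lemma SupportedInCone.deriv {T : EReal} (hT : 0 < T) {R : ℝ} {u : ℝ → L2 N}
    (hu : SupportedInCone T R u) {t : ℝ} (ht : t ∈ timeInterval T) {w : L2 N}
    (hd : HasDerivWithinAt u w (timeInterval T) t) : SupportedInBall (t + R + 1) w := by
  set A : Set (Space N) := {x | t + R + 1 < ‖x‖} with hA
  have hAm : MeasurableSet A := measurableSet_lt measurable_const measurable_norm
  set Λ := LpToLpRestrictCLM (Space N) ℝ ℝ (volume : Measure (Space N)) 2 A with hΛ
  have h1 : HasDerivWithinAt (fun s => Λ (u s)) (Λ w) (timeInterval T) t :=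
    Λ.hasFDerivAt.comp_hasDerivWithinAt t hd
  have hzero : ∀ s ∈ timeInterval T, s < t + 1 → Λ (u s) = 0 := by
    intro s hs hst
    rw [Lp.eq_zero_iff_ae_eq_zero]
    refine (LpToLpRestrictCLM_coeFn ℝ A (u s)).trans ?_
    refine (ae_restrict_iff' hAm).2 ?_
    filter_upwards [hu s hs] with x hx hxA
    exact hx (by have : t + R + 1 < ‖x‖ := hxA
                 linarith)
  have h2 : HasDerivWithinAt (fun s => Λ (u s)) 0 (timeInterval T) t := by
    refine (hasDerivWithinAt_const t (timeInterval T) 0).congr_of_eventuallyEq ?_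
      (hzero t ht (by linarith))
    filter_upwards [self_mem_nhdsWithin, mem_nhdsWithin_of_mem_nhds (Iio_mem_nhds
      (show t < t + 1 by linarith))] with s hs hst
    exact hzero s hs hst
  have h3 : Λ w = 0 := (uniqueDiffOn_timeInterval hT t ht).eq_deriv _ h1 h2
  have h4 := (LpToLpRestrictCLM_coeFn ℝ A w).symm.trans
    ((Lp.eq_zero_iff_ae_eq_zero).1 h3)
  exact (ae_restrict_iff' hAm).1 h4

end Support

section Modes

variable {N : ℕ}

/-- The pairing `∫ w φ` of `w` with the radial solution `φ` of `Δφ = φ`. -/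
noncomputable def expMode (w : L2 N) : ℝ := ∫ x, w x * radialExp N x

/-- The pairing `∫ |w|^r φ`, which is `0` by convention when the integral diverges. -/
noncomputable def expPowerMode (r : ℝ) (w : L2 N) : ℝ := ∫ x, |w x| ^ r * radialExp N x

/-- The pairing `∫ |w|^r φ` as an extended nonnegative number. -/
noncomputable def expPowerLMode (r : ℝ) (w : L2 N) : ENNReal :=
  ∫⁻ x, ‖w x‖ₑ ^ r * ‖radialExp N x‖ₑ

lemma enorm_abs_rpow_mul {r : ℝ} (hr : 0 ≤ r) (y b : ℝ) :
    ‖|y| ^ r * b‖ₑ = ‖y‖ₑ ^ r * ‖b‖ₑ := by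
  rw [enorm_mul, Real.enorm_rpow_of_nonneg (abs_nonneg y) hr, Real.enorm_abs]

lemma measurable_radialExp (hN : 1 ≤ N) : Measurable (radialExp N) :=
  (contDiff_radialExp hN).continuous.measurable

lemma aestronglyMeasurable_power (hN : 1 ≤ N) (r : ℝ) (w : L2 N) :
    AEStronglyMeasurable (fun x => |w x| ^ r * radialExp N x) volume := by
  have h1 : AEMeasurable (fun x => w x) volume := (Lp.aestronglyMeasurable w).aemeasurable
  have h2 : AEMeasurable (fun x => |w x|) volume :=
    continuous_abs.measurable.comp_aemeasurable h1
  exact ((h2.pow_const r).mul (measurable_radialExp hN).aemeasurable).aestronglyMeasurable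

lemma expPowerMode_eq_toReal (hN : 1 ≤ N) {r : ℝ} (hr : 0 ≤ r) (w : L2 N) :
    expPowerMode r w = (expPowerLMode r w).toReal := by
  rw [expPowerMode, integral_eq_lintegral_of_nonneg_ae
    (ae_of_all _ fun x => mul_nonneg (Real.rpow_nonneg (abs_nonneg _) _) (radialExp_pos hN x).le)
    (aestronglyMeasurable_power hN r w), expPowerLMode]
  congr 1
  refine lintegral_congr fun x => ?_
  rw [← enorm_abs_rpow_mul hr, Real.enorm_eq_ofReal]
  exact mul_nonneg (Real.rpow_nonneg (abs_nonneg _) _) (radialExp_pos hN x).le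

/-- Lower semicontinuity, by Fatou's lemma along an almost everywhere convergent subsequence. -/
lemma lowerSemicontinuous_expPowerLMode (hN : 1 ≤ N) (r : ℝ) :
    LowerSemicontinuous (expPowerLMode (N := N) r) := by
  rw [lowerSemicontinuous_iff_isClosed_preimage]
  intro y
  refine IsSeqClosed.isClosed fun w w₀ hw hlim => ?_
  have hmeas : TendstoInMeasure volume (fun n x => w n x) atTop (fun x => w₀ x) :=
    tendstoInMeasure_of_tendsto_Lp hlim
  obtain ⟨ns, -, hae⟩ := hmeas.exists_seq_tendsto_ae
  have h1 : expPowerLMode r w₀ ≤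
      liminf (fun n => ∫⁻ x, ‖w (ns n) x‖ₑ ^ r * ‖radialExp N x‖ₑ) atTop := by
    refine le_trans (lintegral_mono_ae ?_) (lintegral_liminf_le' fun n => ?_)
    · filter_upwards [hae] with x hx
      refine le_of_eq (Tendsto.liminf_eq ?_).symm
      have h2 : Tendsto (fun n => ‖w (ns n) x‖ₑ ^ r) atTop (𝓝 (‖w₀ x‖ₑ ^ r)) :=
        (ENNReal.continuous_rpow_const.tendsto _).comp hx.enorm
      exact ENNReal.Tendsto.mul_const h2 (Or.inr enorm_ne_top)
    · exact ((Lp.aestronglyMeasurable _).enorm.pow_const r).mul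
        (measurable_radialExp hN).enorm.aemeasurable
  refine h1.trans ?_
  refine liminf_le_of_le (by isBoundedDefault) fun b hb => ?_
  obtain ⟨n, hn⟩ := hb.exists
  exact hn.trans (hw (ns n))

end Modes

section Cutoff

variable {N : ℕ}

/-- A compactly supported smooth function equal to `radialExp` on a ball. -/
lemma exists_cutoff_radialExp (hN : 1 ≤ N) {ρ : ℝ} (hρ : 0 < ρ) :
    ∃ f : Space N → ℝ, ContDiff ℝ ∞ f ∧ HasCompactSupport f ∧
      ∀ x, ‖x‖ ≤ ρ → f =ᶠ[𝓝 x] radialExp N := by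
  let χ : ContDiffBump (0 : Space N) := ⟨ρ + 1, ρ + 2, by linarith, by linarith⟩
  refine ⟨fun x => χ x * radialExp N x, χ.contDiff.mul (contDiff_radialExp hN),
    χ.hasCompactSupport.mul_right, fun x hx => ?_⟩
  have : Metric.ball (0 : Space N) (ρ + 1) ∈ 𝓝 x := Metric.isOpen_ball.mem_nhds (by simp; linarith)
  filter_upwards [this] with y hy
  rw [χ.one_of_mem_closedBall (Metric.ball_subset_closedBall hy), one_mul]

/-- A smooth function on `(-1, ∞)` agrees near `[0, t]` with a smooth function whose compact support
stays below `T > t`. -/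
lemma exists_cutoff_time {T : EReal} {t : ℝ} (ht : t ∈ timeInterval T) {a : ℝ → ℝ}
    (ha : ContDiffOn ℝ ∞ a (Ioi (-1))) :
    ∃ b : ℝ → ℝ, ContDiff ℝ ∞ b ∧ HasCompactSupport b ∧ (∀ s ∈ tsupport b, (s : EReal) < T) ∧
      ∀ s ∈ Icc 0 t, b =ᶠ[𝓝 s] a := by
  obtain ⟨t', htt', ht'T⟩ := EReal.lt_iff_exists_real_btwn.1 ht.2
  have htt : t < t' := by exact_mod_cast htt'
  have ht0 := ht.1
  obtain ⟨d, hd0, hd1, hd2⟩ : ∃ d : ℝ, 0 < d ∧ 2 * d ≤ 1 / 2 ∧ t + 2 * d ≤ t' :=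
    ⟨min (1 / 4) ((t' - t) / 2), lt_min (by norm_num) (by linarith),
      by have := min_le_left (1 / 4) ((t' - t) / 2); linarith,
      by have := min_le_right (1 / 4) ((t' - t) / 2); linarith⟩
  let η : ContDiffBump (t / 2 : ℝ) := ⟨t / 2 + d, t / 2 + 2 * d, by linarith, by linarith⟩
  have hsupp : tsupport (fun s => η s * a s) ⊆ Icc (-(1 / 2)) t' := by
    refine (tsupport_mul_subset_left).trans ?_
    rw [η.tsupport_eq]
    intro s hs
    rw [Metric.mem_closedBall, Real.dist_eq, abs_le] at hs
    have e : η.rOut = t / 2 + 2 * d := rfl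
    rw [e] at hs
    constructor <;> linarith [hs.1, hs.2]
  refine ⟨fun s => η s * a s, ?_, η.hasCompactSupport.mul_right, ?_, ?_⟩
  · rw [contDiff_iff_contDiffAt]
    intro s
    rcases lt_or_ge (-1) s with h | h
    · exact η.contDiff.contDiffAt.mul (ha.contDiffAt (Ioi_mem_nhds h))
    · have h1 : s ∉ tsupport (fun s => η s * a s) := fun hs => by
        have := (hsupp hs).1; linarith
      exact (contDiffAt_const (c := (0 : ℝ))).congr_of_eventuallyEq
        (notMem_tsupport_iff_eventuallyEq.1 h1)
  · intro s hs
    exact lt_of_le_of_lt (EReal.coe_le_coe_iff.2 (hsupp hs).2) ht'T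
  · intro s hs
    have : Metric.ball (t / 2) (t / 2 + d) ∈ 𝓝 s := Metric.isOpen_ball.mem_nhds (by
      rw [Metric.mem_ball, Real.dist_eq, abs_lt]; constructor <;> linarith [hs.1, hs.2])
    filter_upwards [this] with y hy
    rw [η.one_of_mem_closedBall (Metric.ball_subset_closedBall hy), one_mul]

lemma isTestFunction_mul {T : EReal} {b : ℝ → ℝ} {f : Space N → ℝ} (hb : ContDiff ℝ ∞ b)
    (hbc : HasCompactSupport b) (hbT : ∀ s ∈ tsupport b, (s : EReal) < T) (hf : ContDiff ℝ ∞ f)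
    (hfc : HasCompactSupport f) : IsTestFunction T (fun s x => b s * f x) := by
  have hsub : tsupport (fun z : ℝ × Space N => b z.1 * f z.2) ⊆ tsupport b ×ˢ tsupport f := by
    refine closure_minimal (fun z hz => ?_) ((isClosed_tsupport b).prod (isClosed_tsupport f))
    rw [Function.mem_support] at hz
    exact ⟨subset_tsupport b (left_ne_zero_of_mul hz), subset_tsupport f (right_ne_zero_of_mul hz)⟩
  exact ⟨(hb.comp contDiff_fst).mul (hf.comp contDiff_snd),
    HasCompactSupport.of_support_subset_isCompact (hbc.isCompact.prod hfc.isCompact)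
      ((subset_tsupport _).trans hsub), fun z hz => hbT _ (hsub hz).1⟩

end Cutoff

section WeakGradient

variable {N : ℕ}

lemma memLp_two_of_compactSupport {f : Space N → ℝ} (hf : Continuous f)
    (hfc : HasCompactSupport f) : MemLp f 2 (volume : Measure (Space N)) :=
  hf.memLp_of_hasCompactSupport hfc

/-- Integration by parts `∫ ∇w · ∇f = - ∫ w Δf`. -/
lemma IsWeakGradient.integral_inner_gradient {w : L2 N} {G : L2Vec N} (h : IsWeakGradient w G)
    {f : Space N → ℝ} (hf : ContDiff ℝ ∞ f) (hfc : HasCompactSupport f) :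
    ∫ x, inner ℝ (G x) (gradient f x) = - ∫ x, w x * ∑ i : Fin N,
      fderiv ℝ (fun y => fderiv ℝ f y (EuclideanSpace.single i 1)) x
        (EuclideanSpace.single i 1) := by
  have hd : ∀ i : Fin N, ContDiff ℝ ∞ (fun y => fderiv ℝ f y (EuclideanSpace.single i 1)) :=
    fun i => (hf.fderiv_right (by simp)).clm_apply contDiff_const
  have hdc : ∀ i : Fin N, HasCompactSupport (fun y => fderiv ℝ f y (EuclideanSpace.single i 1)) :=
    fun i => hfc.fderiv_apply ℝ _
  have hdd : ∀ i : Fin N, Continuous (fun x => fderiv ℝ (fun y => fderiv ℝ f y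
      (EuclideanSpace.single i 1)) x (EuclideanSpace.single i 1)) :=
    fun i => (((hd i).fderiv_right (m := ∞) (by simp)).clm_apply contDiff_const).continuous
  have hddc : ∀ i : Fin N, HasCompactSupport (fun x => fderiv ℝ (fun y => fderiv ℝ f y
      (EuclideanSpace.single i 1)) x (EuclideanSpace.single i 1)) :=
    fun i => (hdc i).fderiv_apply ℝ _
  have e : ∀ x, inner ℝ (G x) (gradient f x)
      = ∑ i : Fin N, G x i * fderiv ℝ f x (EuclideanSpace.single i 1) := by
    intro x
    rw [real_inner_comm, gradient, InnerProductSpace.toDual_symm_apply]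
    conv_lhs => rw [← (EuclideanSpace.basisFun (Fin N) ℝ).sum_repr (G x)]
    rw [map_sum]
    simp
  have hGi : ∀ i : Fin N, MemLp (fun x => G x i) 2 (volume : Measure (Space N)) := fun i =>
    (EuclideanSpace.proj i : Space N →L[ℝ] ℝ).comp_memLp' (Lp.memLp G)
  simp_rw [e, Finset.mul_sum]
  rw [integral_finsetSum, integral_finsetSum, ← Finset.sum_neg_distrib]
  · refine Finset.sum_congr rfl fun i _ => ?_
    rw [h _ (hd i) (hdc i) i, neg_neg]
  · intro i _
    exact (Lp.memLp w).integrable_mul (memLp_two_of_compactSupport (hdd i) (hddc i))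
  · intro i _
    exact (hGi i).integrable_mul (memLp_two_of_compactSupport (hd i).continuous (hdc i))

end WeakGradient

/-! ### From the weak form to an ordinary differential equation -/

/-- The ordinary differential equation `W'' + μ/(1+t) W' = W + S` on `[0, T)` with `V = W'` and an
integrable source `S ≥ 0`, in integrated form against all smooth weights `a`. -/
structure IsDampedMode (T : EReal) (μ : ℝ) (W V S : ℝ → ℝ) : Prop where
  hasDeriv : ∀ t ∈ timeInterval T, HasDerivWithinAt W (V t) (timeInterval T) t
  continuousOn_deriv : ContinuousOn V (timeInterval T)
  source_nonneg : ∀ t, 0 ≤ S t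
  source_integrable : ∀ t ∈ timeInterval T, IntervalIntegrable S volume 0 t
  weighted : ∀ a : ℝ → ℝ, ContDiffOn ℝ ∞ a (Ioi (-1)) → ∀ t ∈ timeInterval T,
    a t * V t = a 0 * V 0 + ((∫ s in (0 : ℝ)..t, (deriv a s * V s + a s * W s
      - μ / (1 + s) * (a s * V s))) + ∫ s in (0 : ℝ)..t, a s * S s)

section WeakForm

variable {N : ℕ}

lemma exists_clm_eq_integral_mul {f : Space N → ℝ} (hf : Continuous f) (hfc : HasCompactSupport f) :
    ∃ ℓ : L2 N →L[ℝ] ℝ, ∀ w : L2 N, ℓ w = ∫ x, w x * f x := by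
  have hF := memLp_two_of_compactSupport hf hfc
  refine ⟨innerSL ℝ (hF.toLp f), fun w => ?_⟩
  rw [innerSL_apply_apply, L2.inner_def]
  refine integral_congr_ae ?_
  filter_upwards [hF.coeFn_toLp] with x hx
  rw [hx]; simp

lemma integral_mul_eq_of_supported {ρ : ℝ} {w : L2 N} (hw : SupportedInBall ρ w)
    {f g : Space N → ℝ} (hfg : ∀ x, ‖x‖ ≤ ρ → f x = g x) :
    ∫ x, w x * f x = ∫ x, w x * g x := by
  refine integral_congr_ae ?_
  filter_upwards [hw] with x hx
  rcases le_or_gt ‖x‖ ρ with h | h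
  · rw [hfg x h]
  · rw [hx h, zero_mul, zero_mul]

/-- On bounded time intervals the mode of a curve supported in a cone is given by a bounded linear
functional on `L²`, although `φ` itself is not square integrable. -/
lemma exists_clm_eq_expMode (hN : 1 ≤ N) {T : EReal} {R : ℝ} {u : ℝ → L2 N}
    (hu : ∀ t ∈ timeInterval T, SupportedInBall (t + R) (u t)) (t : ℝ) (ht : 0 ≤ t) :
    ∃ ℓ : L2 N →L[ℝ] ℝ, ∀ s ∈ timeInterval T, s < t + 1 → expMode (u s) = ℓ (u s) := by
  obtain ⟨f, hf, hfc, hfe⟩ := exists_cutoff_radialExp (ρ := t + |R| + 1) hN (by positivity)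
  obtain ⟨ℓ, hℓ⟩ := exists_clm_eq_integral_mul hf.continuous hfc
  refine ⟨ℓ, fun s hs hst => ?_⟩
  rw [hℓ]
  refine integral_mul_eq_of_supported (hu s hs) fun x hx => ?_
  refine ((hfe x ?_).eq_of_nhds).symm
  linarith [le_abs_self R]

lemma hasDerivWithinAt_expMode (hN : 1 ≤ N) {T : EReal} {R : ℝ} {u : ℝ → L2 N}
    (hu : ∀ t ∈ timeInterval T, SupportedInBall (t + R) (u t)) {w : L2 N} {t : ℝ}
    (ht : t ∈ timeInterval T) (hw : SupportedInBall (t + R + 1) w)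
    (hd : HasDerivWithinAt u w (timeInterval T) t) :
    HasDerivWithinAt (fun s => expMode (u s)) (expMode w) (timeInterval T) t := by
  obtain ⟨f, hf, hfc, hfe⟩ := exists_cutoff_radialExp (ρ := t + |R| + 1) hN
    (by have := ht.1; positivity)
  have hf' : ∀ x, ‖x‖ ≤ t + R + 1 → radialExp N x = f x := fun x hx =>
    ((hfe x (by linarith [le_abs_self R])).eq_of_nhds).symm
  obtain ⟨ℓ, hℓ⟩ := exists_clm_eq_integral_mul hf.continuous hfc
  have e : ∀ s ∈ timeInterval T, s < t + 1 → expMode (u s) = ℓ (u s) := fun s hs hst => by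
    rw [hℓ]
    exact integral_mul_eq_of_supported ((hu s hs).mono (by linarith)) hf'
  have e' : expMode w = ℓ w := by rw [hℓ]; exact integral_mul_eq_of_supported hw hf'
  rw [e']
  refine (ℓ.hasFDerivAt.comp_hasDerivWithinAt t hd).congr_of_eventuallyEq ?_
    (e t ht (by linarith))
  filter_upwards [self_mem_nhdsWithin, mem_nhdsWithin_of_mem_nhds (Iio_mem_nhds
      (show t < t + 1 by linarith))] with s hs hst
  exact e s hs hst

lemma continuousOn_expMode (hN : 1 ≤ N) {T : EReal} {R : ℝ} {u : ℝ → L2 N}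
    (hu : ∀ t ∈ timeInterval T, SupportedInBall (t + R) (u t))
    (hc : ContinuousOn u (timeInterval T)) :
    ContinuousOn (fun s => expMode (u s)) (timeInterval T) := by
  intro t ht
  obtain ⟨ℓ, hℓ⟩ := exists_clm_eq_expMode hN hu t ht.1
  refine (ℓ.continuous.continuousAt.comp_continuousWithinAt (hc t ht)).congr_of_eventuallyEq ?_
    (hℓ t ht (by linarith))
  filter_upwards [self_mem_nhdsWithin, mem_nhdsWithin_of_mem_nhds (Iio_mem_nhds
      (show t < t + 1 by linarith))] with s hs hst
  exact hℓ s hs hst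

/-- Integrability in time of `∫ |w|^r φ`, from the absolute convergence of the right-hand side in
the weak form. Measurability in time comes from lower semicontinuity on `L²`. -/
lemma integrableOn_expPowerMode (hN : 1 ≤ N) {r : ℝ} (hr : 0 ≤ r) {t : ℝ} {w : ℝ → L2 N}
    (hc : ContinuousOn w (Ioc 0 t))
    (hfin : ∫⁻ s in Ioc 0 t, expPowerLMode r (w s) < ⊤) :
    IntegrableOn (fun s => expPowerMode r (w s)) (Ioc 0 t) volume ∧
      ∀ᵐ s ∂(volume.restrict (Ioc 0 t)), expPowerLMode r (w s) < ⊤ := by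
  borelize (L2 N)
  have hm : AEMeasurable w (volume.restrict (Ioc 0 t)) := hc.aemeasurable measurableSet_Ioc
  have hm2 : AEMeasurable (fun s => expPowerLMode r (w s)) (volume.restrict (Ioc 0 t)) :=
    (lowerSemicontinuous_expPowerLMode hN r).measurable.comp_aemeasurable hm
  simp_rw [expPowerMode_eq_toReal hN hr]
  exact ⟨integrable_toReal_of_lintegral_ne_top hm2 hfin.ne, ae_lt_top' hm2 hfin.ne⟩

/-- Testing the weak form with `a(t) φ(x)`, suitably cut off. The second conclusion excludes that
`expPowerMode` is the junk value of a divergent integral on a set of times of positive measure. -/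
lemma isDampedMode_of_weakForm (hN : 1 ≤ N) {T : EReal} (hT : 0 < T) {R μ r : ℝ} (hr : 0 < r)
    {u ut w : ℝ → L2 N} {Du : ℝ → L2Vec N} (hcurve : IsEnergyCurve T u ut Du)
    (hu : SupportedInCone T R u) (hwc : ContinuousOn w (timeInterval T))
    (hw : ∀ t ∈ timeInterval T, SupportedInBall (t + R + 1) (w t))
    (hweak : SatisfiesWeakForm T μ r ut Du w) :
    IsDampedMode T μ (fun t => expMode (u t)) (fun t => expMode (ut t))
      (fun t => expPowerMode r (w t)) ∧
    ∀ t ∈ timeInterval T, ∀ᵐ s ∂(volume.restrict (Ioc 0 t)), expPowerLMode r (w s) < ⊤ := by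
  have hut : ∀ t ∈ timeInterval T, SupportedInBall (t + R + 1) (ut t) := fun t ht =>
    hu.deriv hT ht (hcurve.hasDeriv t ht)
  -- The weight `a = 1` also yields the integrability of the source.
  have key : ∀ a : ℝ → ℝ, ContDiffOn ℝ ∞ a (Ioi (-1)) → ∀ t ∈ timeInterval T,
      ((∀ s ∈ Icc 0 t, a s = 1) → ∫⁻ s in Ioc 0 t, expPowerLMode r (w s) < ⊤) ∧
      a t * expMode (ut t) - a 0 * expMode (ut 0)
        - (∫ s in (0 : ℝ)..t, deriv a s * expMode (ut s))
        + (∫ s in (0 : ℝ)..t, -(a s * expMode (u s)))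
        + (∫ s in (0 : ℝ)..t, μ / (1 + s) * (a s * expMode (ut s)))
        = ∫ s in (0 : ℝ)..t, a s * expPowerMode r (w s) := by
    intro a ha t ht
    obtain ⟨b, hb, hbc, hbT, hbe⟩ := exists_cutoff_time ht ha
    obtain ⟨f, hf, hfc, hfe⟩ := exists_cutoff_radialExp (N := N) (ρ := t + |R| + 1) hN
      (by have := ht.1; positivity)
    have hR := le_abs_self R
    have hfe' : ∀ x, ‖x‖ ≤ t + R + 1 → f x = radialExp N x := fun x hx =>
      (hfe x (by linarith)).eq_of_nhds
    have hb' : ∀ s ∈ Icc 0 t, b s = a s := fun s hs => (hbe s hs).eq_of_nhds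
    have hmode : ∀ s ∈ Icc 0 t, ∫ x, ut s x * f x = expMode (ut s) := fun s hs =>
      integral_mul_eq_of_supported
        ((hut s (Icc_subset_timeInterval ht hs)).mono (by linarith [hs.2])) hfe'
    have hcI : ∀ {g h : ℝ → ℝ}, (∀ s ∈ Icc 0 t, g s = h s) →
        ∫ s in (0 : ℝ)..t, g s = ∫ s in (0 : ℝ)..t, h s := fun hgh =>
      intervalIntegral.integral_congr fun s hs => hgh s (by rwa [uIcc_of_le ht.1] at hs)
    obtain ⟨h1, h2⟩ := hweak _ (isTestFunction_mul hb hbc hbT hf hfc) t ht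
    constructor
    · intro ha1
      refine lt_of_eq_of_lt ?_ h1
      refine setLIntegral_congr_fun measurableSet_Ioc fun s hs => ?_
      have hs' : s ∈ Icc 0 t := ⟨hs.1.le, hs.2⟩
      refine lintegral_congr_ae ?_
      filter_upwards [hw s (Icc_subset_timeInterval ht hs')] with x hx
      rw [hb' s hs', ha1 s hs', one_mul]
      rcases le_or_gt ‖x‖ (s + R + 1) with h | h
      · rw [hfe' x (by linarith [hs.2])]
      · rw [hx h, enorm_zero, ENNReal.zero_rpow_of_pos hr, zero_mul, zero_mul]
    · have i1 : ∀ s ∈ Icc 0 t, ∫ x, ut s x * (b s * f x) = a s * expMode (ut s) := by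
        intro s hs
        rw [← hmode s hs, ← integral_const_mul, ← hb' s hs]
        congr 1; funext x; ring
      have i2 : ∀ s ∈ Icc 0 t, ∫ x, ut s x * deriv (fun τ => b τ * f x) s
          = deriv a s * expMode (ut s) := by
        intro s hs
        rw [← hmode s hs, ← integral_const_mul, ← (hbe s hs).deriv_eq]
        congr 1; funext x
        rw [deriv_mul_const (hb.differentiable (by simp) s)]; ring
      have i3 : ∀ s ∈ Icc 0 t, ∫ x, inner ℝ (Du s x) (gradient (fun x => b s * f x) x)
          = -(a s * expMode (u s)) := by
        intro s hs
        have hsI := Icc_subset_timeInterval ht hs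
        have e1 : ∀ x, inner ℝ (Du s x) (gradient (fun x => b s * f x) x)
            = a s * inner ℝ (Du s x) (gradient f x) := by
          intro x
          rw [gradient, gradient, fderiv_const_mul (hf.differentiable (by simp) x), map_smul,
            inner_smul_right, hb' s hs]
        simp_rw [e1]
        rw [integral_const_mul, (hcurve.weakGradient s hsI).integral_inner_gradient hf hfc,
          mul_neg]
        congr 2
        refine integral_mul_eq_of_supported (hu s hsI) fun x hx => ?_
        rw [← laplacian_radialExp hN]
        refine Finset.sum_congr rfl fun i _ => ?_
        have h3 : (fun y => fderiv ℝ f y (EuclideanSpace.single i 1)) =ᶠ[𝓝 x]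
            fun y => fderiv ℝ (radialExp N) y (EuclideanSpace.single i 1) := by
          have hx' : ‖x‖ ≤ t + |R| + 1 := by linarith [hs.2]
          filter_upwards [(hfe x hx').fderiv (𝕜 := ℝ)] with y hy
          rw [hy]
        rw [h3.fderiv_eq]
      have i4 : ∀ s ∈ Icc 0 t, ∫ x, μ / (1 + s) * ut s x * (b s * f x)
          = μ / (1 + s) * (a s * expMode (ut s)) := by
        intro s hs
        rw [← i1 s hs, ← integral_const_mul]
        congr 1; funext x; ring
      have i5 : ∀ s ∈ Icc 0 t, ∫ x, |w s x| ^ r * (b s * f x) = a s * expPowerMode r (w s) := by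
        intro s hs
        rw [expPowerMode, ← integral_const_mul, ← hb' s hs]
        refine integral_congr_ae ?_
        filter_upwards [hw s (Icc_subset_timeInterval ht hs)] with x hx
        rcases le_or_gt ‖x‖ (s + R + 1) with h | h
        · rw [hfe' x (by linarith [hs.2])]; ring
        · rw [hx h, abs_zero, Real.zero_rpow hr.ne']; ring
      rw [i1 t ⟨ht.1, le_rfl⟩, i1 0 ⟨le_rfl, ht.1⟩, hcI i2, hcI i3, hcI i4, hcI i5] at h2
      exact h2
  have hVc : ContinuousOn (fun t => expMode (ut t)) (timeInterval T) :=
    continuousOn_expMode (R := R + 1) hN (fun t ht => (hut t ht).mono (by linarith))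
      hcurve.continuousOn_deriv
  have hWd : ∀ t ∈ timeInterval T, HasDerivWithinAt (fun t => expMode (u t)) (expMode (ut t))
      (timeInterval T) t := fun t ht =>
    hasDerivWithinAt_expMode hN hu ht (hut t ht) (hcurve.hasDeriv t ht)
  have hint : ∀ t ∈ timeInterval T, IntegrableOn (fun s => expPowerMode r (w s)) (Ioc 0 t) volume ∧
      ∀ᵐ s ∂(volume.restrict (Ioc 0 t)), expPowerLMode r (w s) < ⊤ := fun t ht =>
    integrableOn_expPowerMode hN hr.le (hwc.mono (Ioc_subset_Icc_self.trans
      (Icc_subset_timeInterval ht))) ((key (fun _ => 1) contDiffOn_const t ht).1 fun _ _ => rfl)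
  refine ⟨⟨hWd, hVc, fun t => integral_nonneg fun x =>
    mul_nonneg (Real.rpow_nonneg (abs_nonneg _) _) (radialExp_pos hN x).le, ?_, ?_⟩,
    fun t ht => (hint t ht).2⟩
  · intro t ht
    rw [intervalIntegrable_iff_integrableOn_Ioc_of_le ht.1]
    exact (hint t ht).1
  · intro a ha t ht
    have h := (key a ha t ht).2
    have hsub : Icc 0 t ⊆ Ioi (-1 : ℝ) := fun s hs => by
      have := hs.1; rw [mem_Ioi]; linarith
    have hac : ContinuousOn a (Icc 0 t) := ha.continuousOn.mono hsub
    have hdc : ContinuousOn (deriv a) (Icc 0 t) :=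
      (ha.continuousOn_deriv_of_isOpen isOpen_Ioi (by simp)).mono hsub
    have hV := hVc.mono (Icc_subset_timeInterval ht)
    have hW : ContinuousOn (fun t => expMode (u t)) (Icc 0 t) := fun s hs =>
      ((hWd s (Icc_subset_timeInterval ht hs)).continuousWithinAt).mono
        (Icc_subset_timeInterval ht)
    have hμ : ContinuousOn (fun s : ℝ => μ / (1 + s)) (Icc 0 t) := by
      refine continuousOn_const.div (by fun_prop) fun s hs => ?_
      have := hs.1; positivity
    have c1 : IntervalIntegrable (fun s => deriv a s * expMode (ut s)) volume 0 t :=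
      (hdc.mul hV).intervalIntegrable_of_Icc ht.1
    have c2 : IntervalIntegrable (fun s => a s * expMode (u s)) volume 0 t :=
      (hac.mul hW).intervalIntegrable_of_Icc ht.1
    have c3 : IntervalIntegrable (fun s => μ / (1 + s) * (a s * expMode (ut s))) volume 0 t :=
      (hμ.mul (hac.mul hV)).intervalIntegrable_of_Icc ht.1
    rw [intervalIntegral.integral_sub (c1.add c2) c3, intervalIntegral.integral_add c1 c2]
    rw [intervalIntegral.integral_neg] at h
    linarith

end WeakForm

/-! ### Lower bounds for the damped equation -/

/-- The time factor `e^{-t} (1+t)^m` of the test function. -/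
noncomputable def expWeight (m t : ℝ) : ℝ := Real.exp (-t + m * Real.log (1 + t))

lemma expWeight_pos (m t : ℝ) : 0 < expWeight m t := Real.exp_pos _

lemma continuousOn_expWeight (m t : ℝ) : ContinuousOn (expWeight m) (Icc 0 t) := by
  unfold expWeight
  refine ContinuousOn.rexp (continuousOn_id.neg.add (continuousOn_const.mul
    (ContinuousOn.log (by fun_prop) fun s hs => ?_)))
  have := hs.1; positivity

section DampedMode

variable {T : EReal} {μ : ℝ} {W V S : ℝ → ℝ}

lemma IsDampedMode.hasDerivAt (h : IsDampedMode T μ W V S) {s t : ℝ} (ht : t ∈ timeInterval T)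
    (hs : s ∈ Ioo 0 t) : HasDerivAt W (V s) s := by
  have hsub := Icc_subset_timeInterval ht
  exact (h.hasDeriv s (hsub (Ioo_subset_Icc_self hs))).hasDerivAt
    (mem_of_superset (Icc_mem_nhds hs.1 hs.2) hsub)

lemma IsDampedMode.continuousOn (h : IsDampedMode T μ W V S) : ContinuousOn W (timeInterval T) :=
  fun t ht => (h.hasDeriv t ht).continuousWithinAt

/-- Integration with an integrating factor: if `a = e^A` and `γ` satisfy `a'/a = μ/(1+t) - γ`, then
`(a (V + γ W))' = a S + a (1 + γ' + γ μ/(1+t) - γ²) W`, and a sign condition on the Riccati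
expression makes `γ` a comparison function. -/
lemma IsDampedMode.le_of_riccati (h : IsDampedMode T μ W V S) {A γ γ' : ℝ → ℝ}
    (hA : ContDiffOn ℝ ∞ A (Ioi (-1)))
    (hA' : ∀ s, 0 ≤ s → HasDerivAt A (μ / (1 + s) - γ s) s)
    (hγ : ∀ s, 0 ≤ s → HasDerivAt γ (γ' s) s) (hγ' : ContinuousOn γ' (Ici 0))
    (hric : ∀ s, 0 ≤ s → 0 ≤ 1 + γ' s + γ s * (μ / (1 + s)) - γ s ^ 2)
    (hW : ∀ t ∈ timeInterval T, 0 ≤ W t) {t : ℝ} (ht : t ∈ timeInterval T) :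
    Real.exp (A 0) * (V 0 + γ 0 * W 0) + ∫ s in (0 : ℝ)..t, Real.exp (A s) * S s
      ≤ Real.exp (A t) * (V t + γ t * W t) := by
  have hsub := Icc_subset_timeInterval ht
  have h1 := h.weighted (fun s => Real.exp (A s)) hA.exp t ht
  have hda : ∀ s, 0 ≤ s → HasDerivAt (fun s => Real.exp (A s))
      (Real.exp (A s) * (μ / (1 + s) - γ s)) s := fun s hs => (hA' s hs).exp
  have hcA : ContinuousOn (fun s => Real.exp (A s)) (Icc 0 t) := fun s hs =>
    (hda s hs.1).continuousAt.continuousWithinAt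
  have hcγ : ContinuousOn γ (Icc 0 t) := fun s hs =>
    (hγ s hs.1).continuousAt.continuousWithinAt
  have hcγ' : ContinuousOn γ' (Icc 0 t) := hγ'.mono Icc_subset_Ici_self
  have hcW := h.continuousOn.mono hsub
  have hcV := h.continuousOn_deriv.mono hsub
  have hcμ : ContinuousOn (fun s : ℝ => μ / (1 + s)) (Icc 0 t) := by
    refine continuousOn_const.div (by fun_prop) fun s hs => ?_
    have := hs.1; positivity
  set D : ℝ → ℝ := fun s => (Real.exp (A s) * (μ / (1 + s) - γ s) * γ s
    + Real.exp (A s) * γ' s) * W s + Real.exp (A s) * γ s * V s with hD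
  have hcD : ContinuousOn D (Icc 0 t) := by fun_prop
  have h2 : ∫ s in (0 : ℝ)..t, D s
      = Real.exp (A t) * γ t * W t - Real.exp (A 0) * γ 0 * W 0 := by
    refine intervalIntegral.integral_eq_sub_of_hasDerivAt_of_le ht.1
      (f := fun s => Real.exp (A s) * γ s * W s) ((hcA.mul hcγ).mul hcW) (fun s hs => ?_)
      (hcD.intervalIntegrable_of_Icc ht.1)
    exact ((hda s hs.1.le).mul (hγ s hs.1.le)).mul (h.hasDerivAt ht hs)
  set E : ℝ → ℝ := fun s => Real.exp (A s) * (μ / (1 + s) - γ s) * V s + Real.exp (A s) * W s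
    - μ / (1 + s) * (Real.exp (A s) * V s) with hE
  have hcE : ContinuousOn E (Icc 0 t) := by fun_prop
  have h3 : ∫ s in (0 : ℝ)..t, (deriv (fun s => Real.exp (A s)) s * V s + Real.exp (A s) * W s
      - μ / (1 + s) * (Real.exp (A s) * V s)) = ∫ s in (0 : ℝ)..t, E s := by
    refine intervalIntegral.integral_congr fun s hs => ?_
    rw [uIcc_of_le ht.1] at hs
    simp only [hE, (hda s hs.1).deriv]
  have h4 : 0 ≤ ∫ s in (0 : ℝ)..t, (E s + D s) := by
    refine intervalIntegral.integral_nonneg ht.1 fun s hs => ?_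
    have e : E s + D s
        = Real.exp (A s) * ((1 + γ' s + γ s * (μ / (1 + s)) - γ s ^ 2) * W s) := by
      simp only [hE, hD]; ring
    rw [e]
    exact mul_nonneg (Real.exp_pos _).le (mul_nonneg (hric s hs.1) (hW s (hsub hs)))
  rw [intervalIntegral.integral_add (hcE.intervalIntegrable_of_Icc ht.1)
    (hcD.intervalIntegrable_of_Icc ht.1), h2] at h4
  rw [h3] at h1
  linarith

/-- A negative minimum of `e^{-2t} W` is impossible: it would bound `W` from below by a multiple of
`-e^{2t}`, and integrating the equation twice improves this bound by the factor `4`. -/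
lemma IsDampedMode.nonneg (h : IsDampedMode T μ W V S) (hμ : 0 ≤ μ) (hW0 : 0 ≤ W 0)
    (hV0 : 0 ≤ V 0) {t : ℝ} (ht : t ∈ timeInterval T) : 0 ≤ W t := by
  by_contra hneg
  rw [not_le] at hneg
  have hsub := Icc_subset_timeInterval ht
  obtain ⟨s₀, hs₀, hmin⟩ := isCompact_Icc.exists_isMinOn (nonempty_Icc.2 ht.1)
    (f := fun s => Real.exp (-(2 * s)) * W s)
    (ContinuousOn.mul (by fun_prop) (h.continuousOn.mono hsub))
  set k : ℝ := -(Real.exp (-(2 * s₀)) * W s₀) with hk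
  have hk0 : 0 < k := by
    have h1 : Real.exp (-(2 * s₀)) * W s₀ ≤ Real.exp (-(2 * t)) * W t := hmin ⟨ht.1, le_rfl⟩
    have h2 : Real.exp (-(2 * t)) * W t < 0 := mul_neg_of_pos_of_neg (Real.exp_pos _) hneg
    linarith
  have hexp : ∀ s : ℝ, Real.exp (2 * s) * Real.exp (-(2 * s)) = 1 := fun s => by
    rw [← Real.exp_add]; simp
  have hWk : ∀ s ∈ Icc 0 t, -(k * Real.exp (2 * s)) ≤ W s := by
    intro s hs
    have h1 : -k ≤ Real.exp (-(2 * s)) * W s := by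
      have : Real.exp (-(2 * s₀)) * W s₀ ≤ Real.exp (-(2 * s)) * W s := hmin hs
      rw [hk]; linarith
    have h2 := mul_le_mul_of_nonneg_left h1 (Real.exp_pos (2 * s)).le
    rw [← mul_assoc, hexp, one_mul] at h2
    linarith
  have hV : ∀ τ ∈ Icc 0 t, -(k * Real.exp (2 * τ) / 2) ≤ V τ := by
    intro τ hτ
    have hτI := hsub hτ
    have hA : ContDiffOn ℝ ∞ (fun s : ℝ => μ * Real.log (1 + s)) (Ioi (-1)) :=
      contDiffOn_const.mul (ContDiffOn.log (by fun_prop) fun s hs => by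
        rw [mem_Ioi] at hs; linarith)
    have h1 := h.weighted _ hA.exp τ hτI
    have hcA : ContinuousOn (fun s => Real.exp (μ * Real.log (1 + s))) (Icc 0 τ) :=
      (hA.exp.continuousOn).mono fun s hs => by have := hs.1; rw [mem_Ioi]; linarith
    have hcW : ContinuousOn W (Icc 0 τ) := h.continuousOn.mono (Icc_subset_timeInterval hτI)
    have h2 : ∫ s in (0 : ℝ)..τ, (deriv (fun s => Real.exp (μ * Real.log (1 + s))) s * V s
        + Real.exp (μ * Real.log (1 + s)) * W s
        - μ / (1 + s) * (Real.exp (μ * Real.log (1 + s)) * V s))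
        = ∫ s in (0 : ℝ)..τ, Real.exp (μ * Real.log (1 + s)) * W s := by
      refine intervalIntegral.integral_congr fun s hs => ?_
      rw [uIcc_of_le hτ.1] at hs
      have hs1 : 1 + s ≠ 0 := by have := hs.1; positivity
      have d : HasDerivAt (fun s => Real.exp (μ * Real.log (1 + s)))
          (Real.exp (μ * Real.log (1 + s)) * (μ * (1 / (1 + s)))) s :=
        ((((hasDerivAt_id s).const_add 1).log hs1).const_mul μ).exp
      simp only [d.deriv]
      ring
    have hSi : 0 ≤ ∫ s in (0 : ℝ)..τ, Real.exp (μ * Real.log (1 + s)) * S s :=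
      intervalIntegral.integral_nonneg hτ.1 fun s _ =>
        mul_nonneg (Real.exp_pos _).le (h.source_nonneg s)
    have h3 : ∫ s in (0 : ℝ)..τ, -(Real.exp (μ * Real.log (1 + τ)) * k * Real.exp (2 * s))
        ≤ ∫ s in (0 : ℝ)..τ, Real.exp (μ * Real.log (1 + s)) * W s := by
      refine intervalIntegral.integral_mono_on hτ.1
        (Continuous.intervalIntegrable (by fun_prop) _ _)
        ((hcA.mul hcW).intervalIntegrable_of_Icc hτ.1) fun s hs => ?_
      have h4 := hWk s ⟨hs.1, hs.2.trans hτ.2⟩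
      have h5 : Real.exp (μ * Real.log (1 + s)) ≤ Real.exp (μ * Real.log (1 + τ)) := by
        have : 0 < 1 + s := by linarith [hs.1]
        gcongr; exact hs.2
      have h6 : 0 < Real.exp (μ * Real.log (1 + s)) := Real.exp_pos _
      have h7 : 0 ≤ k * Real.exp (2 * s) := by positivity
      calc -(Real.exp (μ * Real.log (1 + τ)) * k * Real.exp (2 * s))
          ≤ -(Real.exp (μ * Real.log (1 + s)) * (k * Real.exp (2 * s))) := by nlinarith
        _ ≤ _ := by nlinarith
    have h4 : ∫ s in (0 : ℝ)..τ, -(Real.exp (μ * Real.log (1 + τ)) * k * Real.exp (2 * s))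
        = -(Real.exp (μ * Real.log (1 + τ)) * k * ((Real.exp (2 * τ) - 1) / 2)) := by
      rw [intervalIntegral.integral_neg, intervalIntegral.integral_const_mul,
        intervalIntegral.integral_comp_mul_left (fun x => Real.exp x) two_ne_zero, integral_exp,
        mul_zero, Real.exp_zero, smul_eq_mul]
      ring
    rw [h2] at h1
    set a := Real.exp (μ * Real.log (1 + τ)) with ha
    have ha0 : 0 < a := Real.exp_pos _
    have h5 : 0 ≤ Real.exp (μ * Real.log (1 + 0)) * V 0 := mul_nonneg (Real.exp_pos _).le hV0
    have h6 : -(a * k * ((Real.exp (2 * τ) - 1) / 2)) ≤ a * V τ := by linarith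
    have h7 : a * (-(k * Real.exp (2 * τ) / 2)) ≤ a * V τ := by
      have : 0 ≤ a * k := by positivity
      linarith
    exact le_of_mul_le_mul_left h7 ha0
  have hmono : MonotoneOn (fun s => W s + k * Real.exp (2 * s) / 4) (Icc 0 t) := by
    have hder : ∀ s ∈ Ioo 0 t, HasDerivAt (fun s => W s + k * Real.exp (2 * s) / 4)
        (V s + k * Real.exp (2 * s) / 2) s := by
      intro s hs
      have d : HasDerivAt (fun s : ℝ => 2 * s) 2 s := by
        simpa using (hasDerivAt_id s).const_mul 2
      refine ((h.hasDerivAt ht hs).add ((d.exp.const_mul k).div_const 4)).congr_deriv ?_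
      ring
    refine monotoneOn_of_deriv_nonneg (convex_Icc 0 t)
      ((h.continuousOn.mono hsub).add (by fun_prop)) (fun s hs => ?_) (fun s hs => ?_)
    · rw [interior_Icc] at hs
      exact (hder s hs).differentiableAt.differentiableWithinAt
    · rw [interior_Icc] at hs
      rw [(hder s hs).deriv]
      linarith [hV s (Ioo_subset_Icc_self hs)]
  have h1 := hmono ⟨le_rfl, ht.1⟩ hs₀ hs₀.1
  have h2 : W s₀ = -(k * Real.exp (2 * s₀)) := by
    rw [hk]
    calc W s₀ = Real.exp (2 * s₀) * Real.exp (-(2 * s₀)) * W s₀ := by rw [hexp, one_mul]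
      _ = _ := by ring
  have h3 : 0 < k * Real.exp (2 * s₀) := by positivity
  simp only [mul_zero, Real.exp_zero, mul_one] at h1
  linarith

/-- `V ≥ r₀ W` with the Riccati subsolution `r₀ = t / (t + 1 + μ)`. -/
lemma IsDampedMode.deriv_ge (h : IsDampedMode T μ W V S) (hμ : 0 ≤ μ) (hW0 : 0 ≤ W 0)
    (hV0 : 0 ≤ V 0) {t : ℝ} (ht : t ∈ timeInterval T) : t / (t + 1 + μ) * W t ≤ V t := by
  set k : ℝ := 1 + μ with hk
  have hk1 : 1 ≤ k := by linarith
  have h1 := h.le_of_riccati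
    (A := fun s => s - k * Real.log (s + k) + μ * Real.log (1 + s))
    (γ := fun s => -(s / (s + k))) (γ' := fun s => -(k / (s + k) ^ 2)) ?_ ?_ ?_ ?_ ?_
    (fun s hs => h.nonneg hμ hW0 hV0 hs) ht
  · have h2 : 0 ≤ ∫ s in (0 : ℝ)..t, Real.exp (s - k * Real.log (s + k) + μ * Real.log (1 + s))
        * S s :=
      intervalIntegral.integral_nonneg ht.1 fun s _ =>
        mul_nonneg (Real.exp_pos _).le (h.source_nonneg s)
    have h3 : 0 ≤ Real.exp (0 - k * Real.log (0 + k) + μ * Real.log (1 + 0)) *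
        (V 0 + -(0 / (0 + k)) * W 0) :=
      mul_nonneg (Real.exp_pos _).le (by simpa using hV0)
    have h4 := nonneg_of_mul_nonneg_right ((add_nonneg h3 h2).trans h1) (Real.exp_pos _)
    rw [add_assoc]
    linarith
  · have hlog : ∀ c : ℝ, 1 ≤ c → ContDiffOn ℝ ∞ (fun s : ℝ => Real.log (s + c)) (Ioi (-1)) :=
      fun c hc => ContDiffOn.log (by fun_prop) fun s hs => by rw [mem_Ioi] at hs; linarith
    have := hlog 1 le_rfl
    simp_rw [add_comm _ (1 : ℝ)] at this
    exact (contDiffOn_id.sub (contDiffOn_const.mul (hlog k hk1))).add (contDiffOn_const.mul this)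
  · intro s hs
    have e1 : s + k ≠ 0 := by positivity
    have e2 : 1 + s ≠ 0 := by positivity
    refine (((hasDerivAt_id s).sub ((((hasDerivAt_id s).add_const k).log e1).const_mul k)).add
      ((((hasDerivAt_id s).const_add 1).log e2).const_mul μ)).congr_deriv ?_
    simp only [id]
    field_simp
    ring
  · intro s hs
    have e1 : s + k ≠ 0 := by positivity
    refine (((hasDerivAt_id s).div ((hasDerivAt_id s).add_const k) e1).neg).congr_deriv ?_
    simp
  · refine (continuousOn_const.div (by fun_prop) fun s hs => ?_).neg
    have : (0 : ℝ) ≤ s := hs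
    positivity
  · intro s hs
    have e1 : 0 < s + k := by positivity
    have e2 : 0 < 1 + s := by positivity
    have e : 1 + -(k / (s + k) ^ 2) + -(s / (s + k)) * (μ / (1 + s)) - (-(s / (s + k))) ^ 2
        = ((s + k) ^ 2 * (1 + s) - k * (1 + s) - s * μ * (s + k) - s ^ 2 * (1 + s))
          / ((s + k) ^ 2 * (1 + s)) := by
      field_simp
      ring
    rw [e]
    apply div_nonneg _ (by positivity)
    have e3 : (s + k) ^ 2 * (1 + s) - k * (1 + s) - s * μ * (s + k) - s ^ 2 * (1 + s)
        = s ^ 2 * (2 + μ) + s * (2 + 2 * μ) + μ * (1 + μ) := by rw [hk]; ring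
    rw [e3]
    positivity

/-- The main lower bound: with `m = μ/2`, the quantity `e^{-t} (1+t)^m V` controls the data and the
weighted source. The combination `V + γ W` with the Riccati supersolution
`γ = 1 + m/(1+t) - 1/(8 (1+t)²)` has the right growth, and it is comparable to `V` for `t ≥ 1`. -/
lemma exists_lower_bound_dampedMode (hμ : 0 ≤ μ) : ∃ c : ℝ, 0 < c ∧
    ∀ (T : EReal) (W V S : ℝ → ℝ), IsDampedMode T μ W V S → 0 ≤ W 0 → 0 ≤ V 0 →
      ∀ t ∈ timeInterval T, 1 ≤ t →
        c * (V 0 + W 0 + ∫ s in (0 : ℝ)..t, expWeight (μ / 2) s * S s)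
          ≤ expWeight (μ / 2) t * V t := by
  set m : ℝ := μ / 2 with hm
  have hm0 : 0 ≤ m := by positivity
  have hμm : μ = 2 * m := by rw [hm]; ring
  set c₁ : ℝ := Real.exp (-(1 / 8)) * (7 / 8) with hc₁
  set c₂ : ℝ := 1 + (1 + m) * (2 + μ) with hc₂
  have hc₂0 : 0 < c₂ := by positivity
  refine ⟨c₁ / c₂, by positivity, ?_⟩
  intro T W V S h hW0 hV0 t ht ht1
  have hWnn : ∀ s ∈ timeInterval T, 0 ≤ W s := fun s hs => h.nonneg hμ hW0 hV0 hs
  have hcomp : ∀ s : ℝ, 0 ≤ s → Real.exp (-(1 / 8)) * expWeight m s ≤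
      Real.exp (-s - 1 / 8 * (1 + s)⁻¹ + m * Real.log (1 + s)) := by
    intro s hs
    rw [expWeight, ← Real.exp_add]
    apply Real.exp_le_exp.2
    have : (1 + s)⁻¹ ≤ 1 := inv_le_one_of_one_le₀ (by linarith)
    linarith
  have h1 := h.le_of_riccati
    (A := fun s => -s - 1 / 8 * (1 + s)⁻¹ + m * Real.log (1 + s))
    (γ := fun s => 1 + m * (1 + s)⁻¹ - 1 / 8 * ((1 + s)⁻¹) ^ 2)
    (γ' := fun s => -(m * ((1 + s)⁻¹) ^ 2) + 1 / 4 * ((1 + s)⁻¹) ^ 3) ?_ ?_ ?_ ?_ ?_ hWnn ht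
  · set a := Real.exp (-t - 1 / 8 * (1 + t)⁻¹ + m * Real.log (1 + t)) with ha
    have hx0 : 0 < (1 + t)⁻¹ := by positivity
    have hx1 : (1 + t)⁻¹ ≤ 1 := inv_le_one_of_one_le₀ (by linarith)
    have hWt := hWnn t ht
    have hSi : IntervalIntegrable (fun s => expWeight m s * S s) volume 0 t :=
      (h.source_integrable t ht).continuousOn_mul (by
        rw [uIcc_of_le ht.1]; exact continuousOn_expWeight m t)
    have hcA : ContinuousOn (fun s => Real.exp (-s - 1 / 8 * (1 + s)⁻¹ + m * Real.log (1 + s)))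
        (uIcc 0 t) := by
      rw [uIcc_of_le ht.1]
      have hne : ∀ s ∈ Icc 0 t, 1 + s ≠ 0 := fun s hs => by have := hs.1; positivity
      refine ContinuousOn.rexp (((continuousOn_id.neg).sub (continuousOn_const.mul
        (ContinuousOn.inv₀ (by fun_prop) hne))).add (continuousOn_const.mul
        (ContinuousOn.log (by fun_prop) hne)))
    have h2 : Real.exp (-(1 / 8)) * ∫ s in (0 : ℝ)..t, expWeight m s * S s
        ≤ ∫ s in (0 : ℝ)..t, Real.exp (-s - 1 / 8 * (1 + s)⁻¹ + m * Real.log (1 + s)) * S s := by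
      rw [← intervalIntegral.integral_const_mul]
      refine intervalIntegral.integral_mono_on ht.1 (hSi.const_mul _)
        ((h.source_integrable t ht).continuousOn_mul hcA) fun s hs => ?_
      rw [← mul_assoc]
      exact mul_le_mul_of_nonneg_right (hcomp s hs.1) (h.source_nonneg s)
    have h3 : c₁ * (V 0 + W 0) ≤ Real.exp (-0 - 1 / 8 * (1 + 0)⁻¹ + m * Real.log (1 + 0)) *
        (V 0 + (1 + m * (1 + 0)⁻¹ - 1 / 8 * ((1 + 0)⁻¹) ^ 2) * W 0) := by
      have e : Real.exp (-0 - 1 / 8 * (1 + 0)⁻¹ + m * Real.log (1 + 0)) = Real.exp (-(1 / 8)) := by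
        simp
      rw [e, hc₁, mul_assoc]
      refine mul_le_mul_of_nonneg_left ?_ (Real.exp_pos _).le
      norm_num
      nlinarith [mul_nonneg hm0 hW0]
    have hint0 : 0 ≤ ∫ s in (0 : ℝ)..t, expWeight m s * S s :=
      intervalIntegral.integral_nonneg ht.1 fun s _ =>
        mul_nonneg (expWeight_pos m s).le (h.source_nonneg s)
    have h4 : c₁ * (V 0 + W 0 + ∫ s in (0 : ℝ)..t, expWeight m s * S s)
        ≤ a * (V t + (1 + m * (1 + t)⁻¹ - 1 / 8 * ((1 + t)⁻¹) ^ 2) * W t) := by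
      have h5 : c₁ * ∫ s in (0 : ℝ)..t, expWeight m s * S s
          ≤ Real.exp (-(1 / 8)) * ∫ s in (0 : ℝ)..t, expWeight m s * S s := by
        refine mul_le_mul_of_nonneg_right ?_ hint0
        rw [hc₁]; have := Real.exp_pos (-(1 / 8 : ℝ)); linarith
      rw [mul_add]
      linarith
    -- For `t ≥ 1` the term `γ W` is absorbed into `V`, since `r₀ ≥ 1/(2 + μ)` there.
    have h6 : W t ≤ (2 + μ) * V t := by
      have h7 := h.deriv_ge hμ hW0 hV0 ht
      have h8 : 1 / (2 + μ) ≤ t / (t + 1 + μ) := by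
        rw [div_le_div_iff₀ (by positivity) (by positivity)]; nlinarith
      have h9 : 1 / (2 + μ) * W t ≤ V t := (mul_le_mul_of_nonneg_right h8 hWt).trans h7
      have h10 : W t = (2 + μ) * (1 / (2 + μ) * W t) := by field_simp
      rw [h10]
      exact mul_le_mul_of_nonneg_left h9 (by positivity)
    have hVt : 0 ≤ V t := by
      have : 0 ≤ (2 + μ) * V t := hWt.trans h6
      exact nonneg_of_mul_nonneg_right this (by positivity)
    have h7 : V t + (1 + m * (1 + t)⁻¹ - 1 / 8 * ((1 + t)⁻¹) ^ 2) * W t ≤ c₂ * V t := by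
      have h8 : 1 + m * (1 + t)⁻¹ - 1 / 8 * ((1 + t)⁻¹) ^ 2 ≤ 1 + m := by nlinarith
      have h9 : (1 + m * (1 + t)⁻¹ - 1 / 8 * ((1 + t)⁻¹) ^ 2) * W t
          ≤ (1 + m) * ((2 + μ) * V t) :=
        (mul_le_mul_of_nonneg_right h8 hWt).trans (mul_le_mul_of_nonneg_left h6 (by positivity))
      rw [hc₂]; linarith
    have h8 : a ≤ expWeight m t := by
      rw [ha, expWeight]
      exact Real.exp_le_exp.2 (by linarith)
    have h9 : a * (V t + (1 + m * (1 + t)⁻¹ - 1 / 8 * ((1 + t)⁻¹) ^ 2) * W t)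
        ≤ expWeight m t * (c₂ * V t) :=
      (mul_le_mul_of_nonneg_left h7 (Real.exp_pos _).le).trans
        (mul_le_mul_of_nonneg_right h8 (by positivity))
    rw [div_mul_eq_mul_div, div_le_iff₀ hc₂0]
    linarith
  · have hne : ∀ s ∈ Ioi (-1 : ℝ), 1 + s ≠ 0 := fun s hs => by rw [mem_Ioi] at hs; linarith
    exact (contDiffOn_id.neg.sub (contDiffOn_const.mul (ContDiffOn.inv (by fun_prop) hne))).add
      (contDiffOn_const.mul (ContDiffOn.log (by fun_prop) hne))
  · intro s hs
    have e : 1 + s ≠ 0 := by positivity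
    have d : HasDerivAt (fun s : ℝ => (1 + s)⁻¹) (-((1 + s)⁻¹ ^ 2)) s := by
      refine (((hasDerivAt_id s).const_add 1).inv e).congr_deriv ?_
      simp only [id]; field_simp
    refine (((hasDerivAt_id s).neg.sub (d.const_mul (1 / 8))).add
      ((((hasDerivAt_id s).const_add 1).log e).const_mul m)).congr_deriv ?_
    rw [hμm]
    simp only [id]
    field_simp
    ring
  · intro s hs
    have e : 1 + s ≠ 0 := by positivity
    have d : HasDerivAt (fun s : ℝ => (1 + s)⁻¹) (-((1 + s)⁻¹ ^ 2)) s := by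
      refine (((hasDerivAt_id s).const_add 1).inv e).congr_deriv ?_
      simp only [id]; field_simp
    refine (((d.const_mul m).const_add 1).sub ((d.pow 2).const_mul (1 / 8))).congr_deriv ?_
    push_cast
    ring
  · have hc : ContinuousOn (fun s : ℝ => (1 + s)⁻¹) (Ici 0) :=
      ContinuousOn.inv₀ (by fun_prop) fun s hs => by
        have : (0 : ℝ) ≤ s := hs
        positivity
    fun_prop
  · intro s hs
    have hx0 : 0 < (1 + s)⁻¹ := by positivity
    have hx1 : (1 + s)⁻¹ ≤ 1 := inv_le_one_of_one_le₀ (by linarith)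
    rw [hμm, div_eq_mul_inv (2 * m)]
    set x := (1 + s)⁻¹
    have e : 1 + (-(m * x ^ 2) + 1 / 4 * x ^ 3) + (1 + m * x - 1 / 8 * x ^ 2) * (2 * m * x)
        - (1 + m * x - 1 / 8 * x ^ 2) ^ 2
        = x ^ 2 * (m - 1 / 2) ^ 2 + x ^ 3 * (1 / 4 - 1 / 64 * x) := by ring
    rw [e]
    have : 0 ≤ 1 / 4 - 1 / 64 * x := by linarith
    positivity

end DampedMode

/-! ### Blow-up of the system of integral inequalities -/

/-- A pair of nondecreasing functions bounded below by `δ` on `[1, T)` that satisfies the integrated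
form of `G' ≥ c s^α H^p`, `H' ≥ c s^β G^q` over each interval `[s, t]` with `t ≤ 4 s`, on which
the weights `s^α`, `s^β` are comparable to constants. -/
structure IsBlowupPair (T : EReal) (c α β p q δ : ℝ) (G H : ℝ → ℝ) : Prop where
  mono_left : ∀ s t : ℝ, 1 ≤ s → s ≤ t → (t : EReal) < T → G s ≤ G t
  mono_right : ∀ s t : ℝ, 1 ≤ s → s ≤ t → (t : EReal) < T → H s ≤ H t
  le_left : ∀ s : ℝ, 1 ≤ s → (s : EReal) < T → δ ≤ G s
  le_right : ∀ s : ℝ, 1 ≤ s → (s : EReal) < T → δ ≤ H s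
  growth_left : ∀ s t : ℝ, 1 ≤ s → s ≤ t → t ≤ 4 * s → (t : EReal) < T →
    G s + c * (t - s) * s ^ α * H s ^ p ≤ G t
  growth_right : ∀ s t : ℝ, 1 ≤ s → s ≤ t → t ≤ 4 * s → (t : EReal) < T →
    H s + c * (t - s) * s ^ β * G s ^ q ≤ H t

lemma IsBlowupPair.symm {T : EReal} {c α β p q δ : ℝ} {G H : ℝ → ℝ}
    (h : IsBlowupPair T c α β p q δ G H) : IsBlowupPair T c β α q p δ H G :=
  ⟨h.mono_right, h.mono_left, h.le_right, h.le_left, h.growth_right, h.growth_left⟩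

lemma EReal.coe_lt_of_le {T : EReal} {s t : ℝ} (hst : s ≤ t) (ht : (t : EReal) < T) :
    (s : EReal) < T :=
  lt_of_le_of_lt (EReal.coe_le_coe_iff.2 hst) ht

/-- Comparison of powers at comparable points. -/
lemma rpow_neg_abs_mul_rpow_le {b s t : ℝ} (hb : 1 ≤ b) (hs : 0 < s) (hst : s ≤ t)
    (hts : t ≤ b * s) (α : ℝ) : b ^ (-|α|) * s ^ α ≤ t ^ α := by
  have ht : 0 < t := hs.trans_le hst
  rcases le_or_gt 0 α with h | h
  · have h1 : b ^ (-|α|) ≤ 1 := Real.rpow_le_one_of_one_le_of_nonpos hb (by simp)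
    have h2 : s ^ α ≤ t ^ α := Real.rpow_le_rpow hs.le hst h
    have h3 : 0 ≤ s ^ α := Real.rpow_nonneg hs.le _
    nlinarith
  · rw [abs_of_neg h, neg_neg, ← Real.mul_rpow (by linarith) hs.le]
    exact Real.rpow_le_rpow_of_nonpos ht hts h.le

/-- Eliminating `H` from the two inequalities. -/
lemma IsBlowupPair.two_step {T : EReal} {c α β p q δ : ℝ} {G H : ℝ → ℝ}
    (hc : 0 < c) (hp : 1 < p) (hδ : 0 < δ)
    (hGH : IsBlowupPair T c α β p q δ G H) {s h : ℝ} (hs : 1 ≤ s) (hh : 0 ≤ h) (hhs : h ≤ s)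
    (hT : ((s + 2 * h : ℝ) : EReal) < T) :
    G s + c ^ (p + 1) * 2 ^ (-|α|) * h ^ (p + 1) * s ^ (α + p * β) * G s ^ (p * q)
      ≤ G (s + 2 * h) := by
  have hs0 : 0 < s := by linarith
  have hT1 : ((s + h : ℝ) : EReal) < T := EReal.coe_lt_of_le (by linarith) hT
  have hT0 : ((s : ℝ) : EReal) < T := EReal.coe_lt_of_le (by linarith) hT
  have hG : 0 < G s := hδ.trans_le (hGH.le_left s hs hT0)
  have h1 := hGH.growth_right s (s + h) hs (by linarith) (by linarith) hT1
  have h2 := hGH.growth_left (s + h) (s + 2 * h) (by linarith) (by linarith) (by linarith) hT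
  have h3 := hGH.mono_left s (s + h) hs (by linarith) hT1
  have h4 := hδ.trans_le (hGH.le_right s hs hT0)
  have e1 : s + h - s = h := by ring
  have e2 : s + 2 * h - (s + h) = h := by ring
  rw [e1] at h1
  rw [e2] at h2
  have hA : 0 ≤ c * h * s ^ β * G s ^ q := by positivity
  have h5 : (c * h * s ^ β * G s ^ q) ^ p ≤ H (s + h) ^ p :=
    Real.rpow_le_rpow hA (by linarith) (by linarith)
  have h6 := rpow_neg_abs_mul_rpow_le one_le_two hs0 (t := s + h) (by linarith) (by linarith) α
  have h7 : c * h * (2 ^ (-|α|) * s ^ α) * (c * h * s ^ β * G s ^ q) ^ p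
      ≤ c * h * (s + h) ^ α * H (s + h) ^ p := by gcongr
  have h8 : c * h * (2 ^ (-|α|) * s ^ α) * (c * h * s ^ β * G s ^ q) ^ p
      = c ^ (p + 1) * 2 ^ (-|α|) * h ^ (p + 1) * s ^ (α + p * β) * G s ^ (p * q) := by
    rw [Real.mul_rpow (by positivity) (by positivity),
      Real.mul_rpow (by positivity) (by positivity), Real.mul_rpow hc.le hh,
      ← Real.rpow_mul hs0.le, ← Real.rpow_mul hG.le, Real.rpow_add hs0,
      Real.rpow_add_one hc.ne', Real.rpow_add_one' hh (by linarith), mul_comm β p, mul_comm q p]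
    ring
  linarith

/-- If `G (s + 2 h) ≥ c h^e s^ν G(s)^P` for `0 ≤ h ≤ s`, then a sufficiently large value of
`s^(e+ν) G(s)^(P-1)` forces `G` to become infinite before time `2 s`: iterate with steps
`2 h = 2⁻ᵏ⁻¹ s`. -/
lemma lifespan_le_two_mul_of_large {c e ν P : ℝ} (hc : 0 < c) (he : 0 < e) (hP : 1 < P) :
    ∃ K : ℝ, 0 < K ∧ ∀ (T : EReal) (G : ℝ → ℝ),
      (∀ s t : ℝ, 1 ≤ s → s ≤ t → (t : EReal) < T → G s ≤ G t) →
      (∀ s h : ℝ, 1 ≤ s → 0 ≤ h → h ≤ s → ((s + 2 * h : ℝ) : EReal) < T →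
        c * h ^ e * s ^ ν * G s ^ P ≤ G (s + 2 * h)) →
      ∀ s : ℝ, 1 ≤ s → 0 < G s → K ≤ s ^ (e + ν) * G s ^ (P - 1) →
        T ≤ ((2 * s : ℝ) : EReal) := by
  set B : ℝ := 2 ^ (e / (P - 1)) with hB
  have hP1 : 0 < P - 1 := by linarith
  have hB1 : 1 < B := Real.one_lt_rpow (by norm_num) (by positivity)
  have hBP : B ^ (P - 1) = 2 ^ e := by
    rw [hB, ← Real.rpow_mul (by norm_num)]; congr 1; field_simp
  refine ⟨B * 4 ^ e * 2 ^ |ν| / c, by positivity, ?_⟩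
  intro T G hmono hstep s hs hGs hK
  by_contra hT
  rw [not_le] at hT
  have hs0 : 0 < s := by linarith
  have key : ∀ k : ℕ, B ^ k * G s ≤ G (s * (2 - (1 / 2) ^ k)) := by
    intro k
    induction k with
    | zero => simp; norm_num
    | succ k ih =>
      set x : ℝ := (1 / 2) ^ k with hx
      have hx0 : 0 < x := by positivity
      have hx1 : x ≤ 1 := pow_le_one₀ (by norm_num) (by norm_num)
      have h1 : s ≤ s * (2 - x) := by nlinarith
      have h2 : s * (2 - x) ≤ 2 * s := by nlinarith
      have e1 : s * (2 - x) + 2 * (s * x / 4) = s * (2 - (1 / 2) ^ (k + 1)) := by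
        rw [pow_succ]; ring
      have h3 := hstep (s * (2 - x)) (s * x / 4) (by linarith) (by positivity) (by nlinarith)
        (EReal.coe_lt_of_le (by nlinarith) hT)
      rw [e1] at h3
      refine le_trans ?_ h3
      have h4 := rpow_neg_abs_mul_rpow_le one_le_two hs0 h1 h2 ν
      have h5 : (B ^ k * G s) ^ P ≤ G (s * (2 - x)) ^ P :=
        Real.rpow_le_rpow (by positivity) ih (by linarith)
      have h6 : c * (s * x / 4) ^ e * (2 ^ (-|ν|) * s ^ ν) * (B ^ k * G s) ^ P ≤
          c * (s * x / 4) ^ e * (s * (2 - x)) ^ ν * G (s * (2 - x)) ^ P := by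
        have : 0 < s * (2 - x) := by linarith
        gcongr
      refine le_trans ?_ h6
      -- `B ^ (P - 1) = 2 ^ e` is the choice for which the powers of `2⁻ᵏ` cancel.
      have h7 : (B ^ k) ^ P = B ^ k * (2 ^ e) ^ k := by
        rw [← hBP, ← Real.rpow_natCast (B ^ (P - 1)), ← Real.rpow_mul (by positivity),
          mul_comm (P - 1), Real.rpow_mul (by positivity), Real.rpow_natCast,
          ← Real.rpow_one_add' (by positivity) (by linarith)]
        congr 1; ring
      have h8 : G s ^ P = G s ^ (P - 1) * G s := by
        rw [← Real.rpow_add_one hGs.ne']; congr 1; ring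
      have h9 : x ^ e * (2 ^ e) ^ k = 1 := by
        rw [hx, ← Real.rpow_natCast (2 ^ e), ← Real.rpow_mul (by norm_num), mul_comm e,
          Real.rpow_mul (by norm_num), Real.rpow_natCast, ← Real.mul_rpow (by positivity)
          (by positivity), ← mul_pow]
        norm_num
      have h10 : c * (s * x / 4) ^ e * (2 ^ (-|ν|) * s ^ ν) * (B ^ k * G s) ^ P
          = (c / 4 ^ e / 2 ^ |ν| * (s ^ (e + ν) * G s ^ (P - 1))) * (B ^ k * G s) := by
        rw [Real.mul_rpow (by positivity) hGs.le, h7, h8,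
          Real.div_rpow (by positivity) (by norm_num), Real.mul_rpow hs0.le hx0.le,
          Real.rpow_add hs0, Real.rpow_neg (by norm_num)]
        calc _ = c * s ^ e / 4 ^ e * (2 ^ |ν|)⁻¹ * s ^ ν * B ^ k * G s ^ (P - 1) * G s
              * (x ^ e * (2 ^ e) ^ k) := by ring
          _ = _ := by rw [h9]; ring
      rw [h10, pow_succ, mul_comm (B ^ k) B, mul_assoc]
      gcongr
      calc B = c / 4 ^ e / 2 ^ |ν| * (B * 4 ^ e * 2 ^ |ν| / c) := by field_simp
        _ ≤ _ := by gcongr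
  obtain ⟨k, hk⟩ := pow_unbounded_of_one_lt (G (2 * s) / G s) hB1
  have h1 := key k
  have hx0 : (0 : ℝ) < (1 / 2) ^ k := by positivity
  have hx1 : (1 / 2 : ℝ) ^ k ≤ 1 := pow_le_one₀ (by norm_num) (by norm_num)
  have h2 := hmono (s * (2 - (1 / 2) ^ k)) (2 * s) (by nlinarith) (by nlinarith) hT
  rw [div_lt_iff₀ hGs] at hk
  linarith

/-- In a scale-invariant situation a function growing at least like `G(4ⁿ s) ≥ c nᵉ G(s)ᴾ` doubles
after `n ≈ M^{-(P-1)/e}` steps when starting from the value `M`. The numbers of steps of the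
successive doublings form a geometric series. -/
lemma lifespan_le_exp_of_doubling {c e P K : ℝ} (hc : 0 < c) (he : 0 < e) (hP : 1 < P)
    (hK : 0 < K) :
    ∃ C : ℝ, 0 < C ∧ ∀ (T : EReal) (G : ℝ → ℝ),
      (∀ s : ℝ, 1 ≤ s → (s : EReal) < T → K ≤ G s → T ≤ ((2 * s : ℝ) : EReal)) →
      (∀ (s : ℝ) (n : ℕ), 1 ≤ s → ((4 ^ n * s : ℝ) : EReal) < T →
        c * (n : ℝ) ^ e * G s ^ P ≤ G (4 ^ n * s)) →
      ∀ M s : ℝ, 0 < M → M ≤ K → 1 ≤ s → (s : EReal) < T → M ≤ G s →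
        T ≤ ((2 * s * Real.exp (C * M ^ (-((P - 1) / e))) : ℝ) : EReal) := by
  set κ : ℝ := (P - 1) / e with hκ
  have hκ0 : 0 < κ := div_pos (by linarith) he
  have hP1 : 0 < P - 1 := by linarith
  set A : ℝ := (2 / c) ^ (1 / e) with hA
  have hA0 : 0 < A := by positivity
  set A' : ℝ := A + K ^ κ with hA'
  have hA'0 : 0 < A' := by positivity
  have h2κ : (2 : ℝ) ^ (-κ) < 1 := Real.rpow_lt_one_of_one_lt_of_neg (by norm_num) (by linarith)
  have hl4 : 0 < Real.log 4 := Real.log_pos (by norm_num)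
  set C : ℝ := A' * Real.log 4 / (1 - 2 ^ (-κ)) with hC
  have hCpos : 0 < C := div_pos (by positivity) (by linarith)
  have hCeq : A' * Real.log 4 + C * 2 ^ (-κ) = C := by
    have : 1 - (2 : ℝ) ^ (-κ) ≠ 0 := by linarith
    rw [hC]; field_simp; ring
  refine ⟨C, hCpos, ?_⟩
  intro T G hlarge hdouble
  have base : ∀ M s : ℝ, 0 < M → 1 ≤ s → (s : EReal) < T → K ≤ G s →
      T ≤ ((2 * s * Real.exp (C * M ^ (-κ)) : ℝ) : EReal) := by
    intro M s hM hs hsT hG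
    refine (hlarge s hs hsT hG).trans (EReal.coe_le_coe_iff.2 ?_)
    have : 1 ≤ Real.exp (C * M ^ (-κ)) := Real.one_le_exp (by positivity)
    nlinarith
  have main : ∀ (k : ℕ) (M s : ℝ), 0 < M → M ≤ K → K ≤ 2 ^ k * M → 1 ≤ s → (s : EReal) < T →
      M ≤ G s → T ≤ ((2 * s * Real.exp (C * M ^ (-κ)) : ℝ) : EReal) := by
    intro k
    induction k with
    | zero =>
      intro M s hM hMK hKM hs hsT hG
      exact base M s hM hs hsT (by simp at hKM; linarith)
    | succ k ih =>
      intro M s hM hMK hKM hs hsT hG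
      set n : ℕ := ⌈A * M ^ (-κ)⌉₊ with hn
      have hn1 : A * M ^ (-κ) ≤ n := Nat.le_ceil _
      have hn2 : (n : ℝ) ≤ A' * M ^ (-κ) := by
        have h1 : (n : ℝ) < A * M ^ (-κ) + 1 := Nat.ceil_lt_add_one (by positivity)
        have h2 : 1 ≤ K ^ κ * M ^ (-κ) := by
          rw [Real.rpow_neg hM.le, ← div_eq_mul_inv, one_le_div (by positivity)]
          exact Real.rpow_le_rpow hM.le hMK hκ0.le
        rw [hA', add_mul]; linarith
      have hexp : (4 : ℝ) ^ n * Real.exp (C * (2 * M) ^ (-κ)) ≤ Real.exp (C * M ^ (-κ)) := by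
        rw [← Real.exp_log (show (0 : ℝ) < 4 ^ n by positivity), ← Real.exp_add, Real.log_pow]
        apply Real.exp_le_exp.2
        rw [Real.mul_rpow (by norm_num) hM.le]
        calc (n : ℝ) * Real.log 4 + C * (2 ^ (-κ) * M ^ (-κ))
            ≤ A' * M ^ (-κ) * Real.log 4 + C * (2 ^ (-κ) * M ^ (-κ)) := by gcongr
          _ = (A' * Real.log 4 + C * 2 ^ (-κ)) * M ^ (-κ) := by ring
          _ = C * M ^ (-κ) := by rw [hCeq]
      have h4 : (1 : ℝ) ≤ 4 ^ n := one_le_pow₀ (by norm_num)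
      by_cases hsT' : ((4 ^ n * s : ℝ) : EReal) < T
      · have h1 := hdouble s n hs hsT'
        have h2M : 2 * M ≤ G (4 ^ n * s) := by
          refine le_trans ?_ h1
          have h3 : (A * M ^ (-κ)) ^ e ≤ (n : ℝ) ^ e :=
            Real.rpow_le_rpow (by positivity) hn1 he.le
          have h5 : (A * M ^ (-κ)) ^ e = 2 / c * M ^ (-(P - 1)) := by
            rw [Real.mul_rpow (by positivity) (by positivity), hA, ← Real.rpow_mul (by positivity),
              ← Real.rpow_mul hM.le, hκ, one_div_mul_cancel he.ne', Real.rpow_one]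
            congr 2; field_simp
          have h6 : M ^ P ≤ G s ^ P := Real.rpow_le_rpow hM.le hG (by linarith)
          have h7 : M ^ (-(P - 1)) * M ^ P = M := by
            rw [← Real.rpow_add hM]; ring_nf; exact Real.rpow_one M
          calc 2 * M = c * (2 / c * M ^ (-(P - 1))) * M ^ P := by
                rw [mul_assoc, mul_assoc, h7]; field_simp
            _ ≤ c * (n : ℝ) ^ e * G s ^ P := by rw [← h5]; gcongr
        have hs' : 1 ≤ 4 ^ n * s := by nlinarith
        rcases le_or_gt (2 * M) K with h2K | h2K
        · refine (ih (2 * M) (4 ^ n * s) (by positivity) h2K (by rw [pow_succ] at hKM; linarith)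
            hs' hsT' h2M).trans (EReal.coe_le_coe_iff.2 ?_)
          nlinarith
        · refine (base (2 * M) (4 ^ n * s) (by positivity) hs' hsT' (by linarith)).trans
            (EReal.coe_le_coe_iff.2 ?_)
          nlinarith
      · refine (not_lt.1 hsT').trans (EReal.coe_le_coe_iff.2 ?_)
        have : 1 ≤ Real.exp (C * (2 * M) ^ (-κ)) := Real.one_le_exp (by positivity)
        have h5 : (4 : ℝ) ^ n ≤ Real.exp (C * M ^ (-κ)) := by nlinarith
        nlinarith
  intro M s hM hMK hs hsT hG
  obtain ⟨k, hk⟩ := pow_unbounded_of_one_lt (K / M) (show (1 : ℝ) < 2 by norm_num)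
  rw [div_lt_iff₀ hM] at hk
  exact main k M s hM hMK hk.le hs hsT hG

section Lifespan

variable {c α β p q : ℝ}

/-- The lifespan of a pair as in `IsBlowupPair` is at most `2 s` once `G(s)` is large compared to
the power of `s` given by scaling. -/
lemma IsBlowupPair.exists_threshold (hc : 0 < c) (hp : 1 < p) (hq : 1 < q) :
    ∃ K : ℝ, 0 < K ∧ ∀ (T : EReal) (δ : ℝ) (G H : ℝ → ℝ), 0 < δ →
      IsBlowupPair T c α β p q δ G H → ∀ s : ℝ, 1 ≤ s → (s : EReal) < T →
        K ≤ s ^ (p + 1 + (α + p * β)) * G s ^ (p * q - 1) → T ≤ ((2 * s : ℝ) : EReal) := by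
  obtain ⟨K, hK, h⟩ := lifespan_le_two_mul_of_large (c := c ^ (p + 1) * 2 ^ (-|α|)) (e := p + 1)
    (ν := α + p * β) (P := p * q) (by positivity) (by linarith) (by nlinarith)
  refine ⟨K, hK, fun T δ G H hδ hGH s hs hsT hKs => h T G hGH.mono_left ?_ s hs
    (hδ.trans_le (hGH.le_left s hs hsT)) hKs⟩
  intro s h hs hh hhs hT
  have h1 := hGH.two_step hc hp hδ hs hh hhs hT
  have h2 := hδ.trans_le (hGH.le_left s hs (EReal.coe_lt_of_le (by linarith) hT))
  linarith

/-- Subcritical case. -/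
lemma IsBlowupPair.lifespan_subcritical (hc : 0 < c) (hp : 1 < p) (hq : 1 < q)
    (hl : 0 < p + 1 + (α + p * β)) :
    ∃ δ₀ : ℝ, 0 < δ₀ ∧ ∃ C : ℝ, 0 < C ∧ ∀ δ : ℝ, 0 < δ → δ ≤ δ₀ →
      ∀ (T : EReal) (G H : ℝ → ℝ), IsBlowupPair T c α β p q δ G H →
        T ≤ ((C * δ ^ (-((p * q - 1) / (p + 1 + (α + p * β)))) : ℝ) : EReal) := by
  obtain ⟨K, hK, h⟩ := IsBlowupPair.exists_threshold (α := α) (β := β) hc hp hq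
  set l := p + 1 + (α + p * β) with hl'
  have hP : 0 < p * q - 1 := by nlinarith
  refine ⟨K ^ (1 / (p * q - 1)), by positivity, 2 * K ^ (1 / l), by positivity, ?_⟩
  intro δ hδ hδ0 T G H hGH
  -- The time at which the trivial bound `δ ≤ G` reaches the threshold.
  set s : ℝ := K ^ (1 / l) * δ ^ (-((p * q - 1) / l)) with hs
  have hsl : s ^ l = K * δ ^ (-(p * q - 1)) := by
    rw [hs, Real.mul_rpow (by positivity) (by positivity), ← Real.rpow_mul hK.le,
      ← Real.rpow_mul hδ.le, one_div_mul_cancel hl.ne', Real.rpow_one]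
    congr 2; field_simp
  have hs1 : 1 ≤ s := by
    have h1 : 1 ≤ s ^ l := by
      rw [hsl, Real.rpow_neg hδ.le, ← div_eq_mul_inv, one_le_div (by positivity)]
      calc δ ^ (p * q - 1) ≤ (K ^ (1 / (p * q - 1))) ^ (p * q - 1) :=
            Real.rpow_le_rpow hδ.le hδ0 hP.le
        _ = K := by rw [← Real.rpow_mul hK.le, one_div_mul_cancel hP.ne', Real.rpow_one]
    by_contra h2
    exact absurd h1 (not_le.2 (Real.rpow_lt_one (by positivity) (not_le.1 h2) hl))
  rw [mul_assoc, ← hs]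
  by_cases hsT : (s : EReal) < T
  · refine h T δ G H hδ hGH s hs1 hsT ?_
    rw [hsl]
    have h1 : δ ^ (p * q - 1) ≤ G s ^ (p * q - 1) :=
      Real.rpow_le_rpow hδ.le (hGH.le_left s hs1 hsT) hP.le
    calc K = K * δ ^ (-(p * q - 1)) * δ ^ (p * q - 1) := by
          rw [mul_assoc, ← Real.rpow_add hδ]; simp
      _ ≤ _ := by gcongr
  · exact (not_lt.1 hsT).trans (EReal.coe_le_coe_iff.2 (by linarith))

/-- Critical cases: scale invariance and a lower bound for the growth over long time intervals
give an exponential lifespan bound. -/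
lemma IsBlowupPair.lifespan_critical_aux (hc : 0 < c) (hp : 1 < p) (hq : 1 < q)
    (hl : p + 1 + (α + p * β) = 0) {c' e : ℝ} (hc' : 0 < c') (he : 0 < e)
    (hgrow : ∀ (T : EReal) (δ : ℝ) (G H : ℝ → ℝ), 0 < δ → IsBlowupPair T c α β p q δ G H →
      ∀ (s : ℝ) (n : ℕ), 1 ≤ s → ((4 ^ n * s : ℝ) : EReal) < T →
        c' * (n : ℝ) ^ e * G s ^ (p * q) ≤ G (4 ^ n * s)) :
    ∃ δ₀ : ℝ, 0 < δ₀ ∧ ∃ C : ℝ, 0 < C ∧ ∀ δ : ℝ, 0 < δ → δ ≤ δ₀ →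
      ∀ (T : EReal) (G H : ℝ → ℝ), IsBlowupPair T c α β p q δ G H →
        T ≤ ((Real.exp (C * δ ^ (-((p * q - 1) / e))) : ℝ) : EReal) := by
  obtain ⟨K, hK, h⟩ := IsBlowupPair.exists_threshold (α := α) (β := β) hc hp hq
  have hP : 0 < p * q - 1 := by nlinarith
  set K' : ℝ := K ^ (1 / (p * q - 1)) with hK'
  have hK'0 : 0 < K' := by positivity
  obtain ⟨C, hC, h2⟩ := lifespan_le_exp_of_doubling (P := p * q) hc' he (by linarith) hK'0
  refine ⟨min K' 1, by positivity, C + Real.log 2, by positivity, ?_⟩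
  intro δ hδ hδ0 T G H hGH
  have h1δ : 1 ≤ δ ^ (-((p * q - 1) / e)) :=
    Real.one_le_rpow_of_pos_of_le_one_of_nonpos hδ (hδ0.trans (min_le_right _ _))
      (by rw [neg_nonpos]; positivity)
  have hl2 : 0 < Real.log 2 := Real.log_pos (by norm_num)
  have h3 : 2 * Real.exp (C * δ ^ (-((p * q - 1) / e)))
      ≤ Real.exp ((C + Real.log 2) * δ ^ (-((p * q - 1) / e))) := by
    nth_rw 1 [← Real.exp_log (show (0 : ℝ) < 2 by norm_num)]
    rw [← Real.exp_add]
    exact Real.exp_le_exp.2 (by nlinarith)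
  by_cases h1T : ((1 : ℝ) : EReal) < T
  · refine (h2 T G ?_ (fun s n hs hsT => hgrow T δ G H hδ hGH s n hs hsT) δ 1 hδ
      (hδ0.trans (min_le_left _ _)) le_rfl h1T (hGH.le_left 1 le_rfl h1T)).trans
      (EReal.coe_le_coe_iff.2 (by linarith))
    intro s hs hsT hKs
    refine h T δ G H hδ hGH s hs hsT ?_
    rw [hl, Real.rpow_zero, one_mul]
    calc K = K' ^ (p * q - 1) := by
          rw [hK', ← Real.rpow_mul hK.le, one_div_mul_cancel hP.ne', Real.rpow_one]
      _ ≤ _ := Real.rpow_le_rpow hK'0.le hKs hP.le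
  · exact (not_lt.1 h1T).trans (EReal.coe_le_coe_iff.2 (Real.one_le_exp (by positivity)))

/-- Simply critical case. -/
lemma IsBlowupPair.lifespan_critical (hc : 0 < c) (hp : 1 < p) (hq : 1 < q)
    (hl : p + 1 + (α + p * β) = 0) :
    ∃ δ₀ : ℝ, 0 < δ₀ ∧ ∃ C : ℝ, 0 < C ∧ ∀ δ : ℝ, 0 < δ → δ ≤ δ₀ →
      ∀ (T : EReal) (G H : ℝ → ℝ), IsBlowupPair T c α β p q δ G H →
        T ≤ ((Real.exp (C * δ ^ (-(p * q - 1))) : ℝ) : EReal) := by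
  set c' : ℝ := c ^ (p + 1) * 2 ^ (-|α|) * (1 / 2) ^ (p + 1) with hc'
  have hc'0 : 0 < c' := by positivity
  have := IsBlowupPair.lifespan_critical_aux hc hp hq hl hc'0 one_pos ?_
  · simpa using this
  intro T δ G H hδ hGH s n hs hsT
  have hpos : ∀ t : ℝ, 1 ≤ t → (t : EReal) < T → 0 < G t :=
    fun t ht htT => hδ.trans_le (hGH.le_left t ht htT)
  have hs0 : (0 : ℝ) < s := by linarith
  have hpq : 0 < p * q := by nlinarith
  have key : ∀ k : ℕ, ((2 ^ k * s : ℝ) : EReal) < T →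
      G s + c' * k * G s ^ (p * q) ≤ G (2 ^ k * s) := by
    intro k
    induction k with
    | zero => simp
    | succ k ih =>
      intro hk
      have h1 : (1 : ℝ) ≤ 2 ^ k := one_le_pow₀ (by norm_num)
      have e1 : 2 ^ k * s + 2 * (2 ^ k * s / 2) = 2 ^ (k + 1) * s := by rw [pow_succ]; ring
      have hkT : ((2 ^ k * s : ℝ) : EReal) < T :=
        EReal.coe_lt_of_le (by rw [pow_succ]; nlinarith) hk
      have h2 := hGH.two_step hc hp hδ (s := 2 ^ k * s) (h := 2 ^ k * s / 2) (by nlinarith)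
        (by positivity) (by nlinarith) (by rw [e1]; exact hk)
      rw [e1] at h2
      have h3 : (2 ^ k * s / 2) ^ (p + 1) * (2 ^ k * s) ^ (α + p * β) = (1 / 2) ^ (p + 1) := by
        rw [div_eq_mul_one_div, Real.mul_rpow (by positivity) (by norm_num),
          mul_right_comm, ← Real.rpow_add (by positivity), hl, Real.rpow_zero, one_mul]
      have h4 : G s ≤ G (2 ^ k * s) := hGH.mono_left _ _ hs (by nlinarith) hkT
      have h5 : G s ^ (p * q) ≤ G (2 ^ k * s) ^ (p * q) :=
        Real.rpow_le_rpow (hpos s hs (EReal.coe_lt_of_le (by nlinarith) hkT)).le h4 hpq.le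
      have h6 : c ^ (p + 1) * 2 ^ (-|α|) * (2 ^ k * s / 2) ^ (p + 1) * (2 ^ k * s) ^ (α + p * β)
          * G (2 ^ k * s) ^ (p * q) = c' * G (2 ^ k * s) ^ (p * q) := by
        rw [hc', mul_assoc (c ^ (p + 1) * 2 ^ (-|α|)), h3]
      rw [h6] at h2
      have h7 : c' * G s ^ (p * q) ≤ c' * G (2 ^ k * s) ^ (p * q) := by gcongr
      have h8 := ih hkT
      push_cast
      linarith
  have h2n : (1 : ℝ) ≤ 2 ^ n := one_le_pow₀ (by norm_num)
  have e4 : (4 : ℝ) ^ n = 2 ^ n * 2 ^ n := by rw [← mul_pow]; norm_num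
  have hle : (2 : ℝ) ^ n * s ≤ 4 ^ n * s := by
    rw [e4, mul_assoc]
    exact le_mul_of_one_le_left (by positivity) h2n
  have hT2 := EReal.coe_lt_of_le hle hsT
  have h1 := key n hT2
  have h2 := hGH.mono_left (2 ^ n * s) (4 ^ n * s) (by nlinarith) hle hsT
  have h3 := hpos s hs (EReal.coe_lt_of_le (by nlinarith) hT2)
  rw [Real.rpow_one]
  linarith

/-- Doubly critical case, in which both inequalities are separately scale invariant. -/
lemma IsBlowupPair.lifespan_doubly_critical (hc : 0 < c) (hp : 1 < p) (hq : 1 < q)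
    (hα : α = -1) (hβ : β = -1) :
    ∃ δ₀ : ℝ, 0 < δ₀ ∧ ∃ C : ℝ, 0 < C ∧ ∀ δ : ℝ, 0 < δ → δ ≤ δ₀ →
      ∀ (T : EReal) (G H : ℝ → ℝ), IsBlowupPair T c α β p q δ G H →
        T ≤ ((Real.exp (C * δ ^ (-((p * q - 1) / (p + 1)))) : ℝ) : EReal) := by
  have step : ∀ (T : EReal) (δ α β p q : ℝ) (G H : ℝ → ℝ), 0 < p → α = -1 → 0 < δ →
      IsBlowupPair T c α β p q δ G H →
      ∀ (s : ℝ) (n : ℕ), 1 ≤ s → ((2 ^ n * s : ℝ) : EReal) < T →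
        c * n * H s ^ p ≤ G (2 ^ n * s) := by
    intro T δ α β p q G H hp hα hδ hGH s n hs
    have hs0 : (0 : ℝ) < s := by linarith
    induction n with
    | zero =>
      intro hT
      simp only [pow_zero, one_mul] at hT
      simpa using (hδ.trans_le (hGH.le_left s hs hT)).le
    | succ k ih =>
      intro hk
      have h1 : (1 : ℝ) ≤ 2 ^ k := one_le_pow₀ (by norm_num)
      have hkT : ((2 ^ k * s : ℝ) : EReal) < T :=
        EReal.coe_lt_of_le (by rw [pow_succ]; nlinarith) hk
      have h2 := hGH.growth_left (2 ^ k * s) (2 ^ (k + 1) * s) (by nlinarith)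
        (by rw [pow_succ]; nlinarith) (by rw [pow_succ]; nlinarith) hk
      have h3 : (2 ^ (k + 1) * s - 2 ^ k * s) * (2 ^ k * s) ^ α = 1 := by
        rw [hα, Real.rpow_neg_one, pow_succ]; field_simp; ring
      rw [mul_assoc c, h3, mul_one] at h2
      have h4 : H s ≤ H (2 ^ k * s) := hGH.mono_right _ _ hs (by nlinarith) hkT
      have h5 : c * H s ^ p ≤ c * H (2 ^ k * s) ^ p := by
        have := hδ.trans_le (hGH.le_right s hs (EReal.coe_lt_of_le (by nlinarith) hkT))
        gcongr
      have h6 := ih hkT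
      push_cast
      linarith
  refine IsBlowupPair.lifespan_critical_aux hc hp hq (by rw [hα, hβ]; ring)
    (c' := c ^ (p + 1)) (by positivity) (by linarith) ?_
  intro T δ G H hδ hGH s n hs hsT
  have h2n : (1 : ℝ) ≤ 2 ^ n := one_le_pow₀ (by norm_num)
  have e4 : (4 : ℝ) ^ n * s = 2 ^ n * (2 ^ n * s) := by rw [← mul_assoc, ← mul_pow]; norm_num
  rw [e4] at hsT ⊢
  have hT2 : ((2 ^ n * s : ℝ) : EReal) < T :=
    EReal.coe_lt_of_le (le_mul_of_one_le_left (by positivity) h2n) hsT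
  have hG := hδ.trans_le (hGH.le_left s hs (EReal.coe_lt_of_le (by nlinarith) hT2))
  have h1 := step T δ β α q p H G (by linarith) hβ hδ hGH.symm s n hs hT2
  have h2 := step T δ α β p q G H (by linarith) hα hδ hGH (2 ^ n * s) n (by nlinarith) hsT
  refine le_trans ?_ h2
  have h3 : (c * n * G s ^ q) ^ p ≤ H (2 ^ n * s) ^ p :=
    Real.rpow_le_rpow (by positivity) h1 (by linarith)
  calc c ^ (p + 1) * (n : ℝ) ^ (p + 1) * G s ^ (p * q)
      = c * n * (c * n * G s ^ q) ^ p := by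
        rw [Real.mul_rpow (by positivity) (by positivity), Real.mul_rpow hc.le (by positivity),
          ← Real.rpow_mul hG.le, Real.rpow_add_one hc.ne',
          Real.rpow_add_one' (by positivity) (by linarith), mul_comm q p]
        ring
    _ ≤ _ := by gcongr

end Lifespan

/-! ### From energy solutions to integral inequalities -/

section Hoelder

variable {N : ℕ}

lemma integrableOn_radialExp (hN : 1 ≤ N) (ρ : ℝ) :
    IntegrableOn (radialExp N) (Metric.closedBall (0 : Space N) ρ) :=
  (contDiff_radialExp hN).continuous.continuousOn.integrableOn_compact
    (isCompact_closedBall _ _)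

/-- Hölder's inequality with respect to the measure `φ dx` on a ball. -/
lemma expMode_rpow_le (hN : 1 ≤ N) {p : ℝ} (hp : 1 < p) {ρ : ℝ} {w : L2 N}
    (hw : SupportedInBall ρ w) (hfin : expPowerLMode p w < ⊤) :
    |expMode w| ^ p ≤ expPowerMode p w *
      (∫ x in Metric.closedBall (0 : Space N) ρ, radialExp N x) ^ (p - 1) := by
  have hp0 : 0 < p := by linarith
  have hpq : p.HolderConjugate (p / (p - 1)) := Real.HolderConjugate.conjExponent hp
  set q : ℝ := p / (p - 1) with hq
  have hq0 : 0 < q := hpq.symm.pos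
  set B : Set (Space N) := Metric.closedBall 0 ρ with hB
  have hBm : MeasurableSet B := Metric.isClosed_closedBall.measurableSet
  have hφm : Measurable fun x : Space N => ‖radialExp N x‖ₑ := (measurable_radialExp hN).enorm
  have hwm : AEMeasurable (fun x => ‖w x‖ₑ) volume := (Lp.aestronglyMeasurable w).enorm
  set f : Space N → ENNReal := fun x => ‖w x‖ₑ * ‖radialExp N x‖ₑ ^ (1 / p) with hf
  set g : Space N → ENNReal := B.indicator fun x => ‖radialExp N x‖ₑ ^ (1 / q) with hg
  have h1 := ENNReal.lintegral_mul_le_Lp_mul_Lq volume hpq (f := f) (g := g)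
    (hwm.mul (hφm.pow_const _).aemeasurable) ((hφm.pow_const _).indicator hBm).aemeasurable
  have hf2 : ∫⁻ x, f x ^ p = expPowerLMode p w := by
    refine lintegral_congr fun x => ?_
    rw [hf, ENNReal.mul_rpow_of_nonneg _ _ hp0.le, ← ENNReal.rpow_mul,
      one_div_mul_cancel hp0.ne', ENNReal.rpow_one]
  have hg2 : ∫⁻ x, g x ^ q = ∫⁻ x in B, ‖radialExp N x‖ₑ := by
    rw [← lintegral_indicator hBm]
    refine lintegral_congr fun x => ?_
    by_cases hx : x ∈ B
    · rw [hg, indicator_of_mem hx, indicator_of_mem hx, ← ENNReal.rpow_mul,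
        one_div_mul_cancel hq0.ne', ENNReal.rpow_one]
    · rw [hg, indicator_of_notMem hx, indicator_of_notMem hx, ENNReal.zero_rpow_of_pos hq0]
  have hfg : ∫⁻ x, (f * g) x = ∫⁻ x, ‖w x * radialExp N x‖ₑ := by
    refine lintegral_congr_ae ?_
    filter_upwards [hw] with x hx
    rw [Pi.mul_apply, enorm_mul]
    rcases le_or_gt ‖x‖ ρ with h | h
    · rw [hf, hg, indicator_of_mem (by simpa [hB] using h), mul_assoc,
        ← ENNReal.rpow_add_of_nonneg _ _ (by positivity) (by positivity), one_div, one_div,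
        hpq.inv_add_inv_eq_one, ENNReal.rpow_one]
    · simp [hf, hx h]
  rw [hf2, hg2, hfg] at h1
  have h2 : ‖expMode w‖ₑ ≤ ∫⁻ x, ‖w x * radialExp N x‖ₑ := enorm_integral_le_lintegral_enorm _
  have h3 := ENNReal.rpow_le_rpow (h2.trans h1) hp0.le
  have hBfin : ∫⁻ x in B, ‖radialExp N x‖ₑ < ⊤ := (integrableOn_radialExp hN ρ).2
  rw [ENNReal.mul_rpow_of_nonneg _ _ hp0.le, ← ENNReal.rpow_mul, ← ENNReal.rpow_mul,
    one_div_mul_cancel hp0.ne', ENNReal.rpow_one,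
    show 1 / q * p = p - 1 by rw [hq]; field_simp] at h3
  have hp1 : 0 ≤ p - 1 := by linarith
  have h4 := ENNReal.toReal_mono (ENNReal.mul_ne_top hfin.ne
    (ENNReal.rpow_ne_top_of_nonneg hp1 hBfin.ne)) h3
  rw [ENNReal.toReal_mul, ← expPowerMode_eq_toReal hN hp0.le, ← ENNReal.toReal_rpow,
    ← ENNReal.toReal_rpow, toReal_enorm, Real.norm_eq_abs] at h4
  have h5 : ∫ x in B, radialExp N x = (∫⁻ x in B, ‖radialExp N x‖ₑ).toReal := by
    rw [← integral_norm_eq_lintegral_enorm (measurable_radialExp hN).aestronglyMeasurable]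
    refine integral_congr_ae (ae_of_all _ fun x => ?_)
    exact (Real.norm_of_nonneg (radialExp_pos hN x).le).symm
  rwa [h5]

/-- The exponential factors of the test functions cancel, and only a power of time remains. -/
lemma exists_source_lower_bound (hN : 1 ≤ N) {p R m₁ m₂ c₂ : ℝ} (hp : 1 < p) (hR : 0 ≤ R)
    (hc₂ : 0 < c₂) : ∃ c : ℝ, 0 < c ∧ ∀ (w : L2 N) (σ s H : ℝ), 1 ≤ s → s ≤ σ → σ ≤ 4 * s →
      SupportedInBall (σ + R + 1) w → expPowerLMode p w < ⊤ → 0 ≤ H →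
      c₂ * H ≤ expWeight m₂ σ * expMode w →
      c * s ^ ((((N : ℝ) - 1) / 2 + m₁) - p * (((N : ℝ) - 1) / 2 + m₂)) * H ^ p
        ≤ expWeight m₁ σ * expPowerMode p w := by
  obtain ⟨Cφ, hCφ, hφ⟩ := integral_radialExp_le hN
  set n : ℝ := ((N : ℝ) - 1) / 2 with hn
  have hn0 : 0 ≤ n := by have := half_le_half_natCast hN; rw [hn]; linarith
  set α : ℝ := (n + m₁) - p * (n + m₂) with hα
  set K : ℝ := Cφ * ((2 + R) ^ n * Real.exp (R + 1)) with hK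
  have hK0 : 0 < K := by positivity
  refine ⟨c₂ ^ p * K ^ (-(p - 1)) * 5 ^ (-|α|), by positivity, ?_⟩
  intro w σ s H hs hsσ hσs hw hfin hH hcH
  have hs0 : 0 < s := by linarith
  have hσ1 : 0 < 1 + σ := by linarith
  have hS0 : 0 ≤ expPowerMode p w := integral_nonneg fun x =>
    mul_nonneg (Real.rpow_nonneg (abs_nonneg _) _) (radialExp_pos hN x).le
  have h1 := expMode_rpow_le hN hp hw hfin
  set I : ℝ := ∫ x in Metric.closedBall (0 : Space N) (σ + R + 1), radialExp N x with hI
  have hI0 : 0 ≤ I := integral_nonneg fun x => (radialExp_pos hN x).le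
  have hI1 : I ≤ K * ((1 + σ) ^ n * Real.exp σ) := by
    refine (hφ (σ + R + 1) (by linarith)).trans ?_
    have h2 : (1 + (σ + R + 1)) ^ n ≤ (2 + R) ^ n * (1 + σ) ^ n := by
      rw [← Real.mul_rpow (by positivity) hσ1.le]
      refine Real.rpow_le_rpow (by linarith) ?_ hn0
      nlinarith
    have h3 : Real.exp (σ + R + 1) = Real.exp (R + 1) * Real.exp σ := by
      rw [← Real.exp_add]; congr 1; ring
    rw [h3]
    calc Cφ * ((1 + (σ + R + 1)) ^ n * (Real.exp (R + 1) * Real.exp σ))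
        ≤ Cφ * ((2 + R) ^ n * (1 + σ) ^ n * (Real.exp (R + 1) * Real.exp σ)) := by gcongr
      _ = _ := by rw [hK]; ring
  have hw2 : expWeight m₂ σ ≠ 0 := (expWeight_pos m₂ σ).ne'
  have hV : c₂ * H * (expWeight m₂ σ)⁻¹ ≤ |expMode w| := by
    refine le_trans ?_ (le_abs_self _)
    rw [← div_eq_mul_inv, div_le_iff₀ (expWeight_pos m₂ σ)]
    linarith
  have h2 : (c₂ * H * (expWeight m₂ σ)⁻¹) ^ p ≤
      expPowerMode p w * (K * ((1 + σ) ^ n * Real.exp σ)) ^ (p - 1) := by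
    have hp1 : 0 ≤ p - 1 := by linarith
    have hpos := expWeight_pos m₂ σ
    calc (c₂ * H * (expWeight m₂ σ)⁻¹) ^ p ≤ |expMode w| ^ p :=
          Real.rpow_le_rpow (by positivity) hV (by linarith)
      _ ≤ expPowerMode p w * I ^ (p - 1) := h1
      _ ≤ _ := by gcongr
  set L : ℝ := K * ((1 + σ) ^ n * Real.exp σ) with hL
  have hL0 : 0 < L := by positivity
  have h3 : expWeight m₁ σ * ((c₂ * H * (expWeight m₂ σ)⁻¹) ^ p * L ^ (-(p - 1)))
      ≤ expWeight m₁ σ * expPowerMode p w := by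
    refine mul_le_mul_of_nonneg_left ?_ (expWeight_pos m₁ σ).le
    calc (c₂ * H * (expWeight m₂ σ)⁻¹) ^ p * L ^ (-(p - 1))
        ≤ expPowerMode p w * L ^ (p - 1) * L ^ (-(p - 1)) := by gcongr
      _ = expPowerMode p w := by rw [mul_assoc, ← Real.rpow_add hL0]; simp
  refine le_trans ?_ h3
  have h4 : expWeight m₁ σ * ((expWeight m₂ σ)⁻¹ ^ p * ((1 + σ) ^ n * Real.exp σ) ^ (-(p - 1)))
      = (1 + σ) ^ α := by
    have e1 : (1 + σ) ^ n * Real.exp σ = Real.exp (n * Real.log (1 + σ) + σ) := by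
      rw [Real.exp_add, Real.rpow_def_of_pos hσ1, mul_comm n]
    rw [e1, Real.rpow_def_of_pos hσ1, expWeight, expWeight, ← Real.exp_neg, ← Real.exp_mul,
      ← Real.exp_mul, ← Real.exp_add, ← Real.exp_add, hα]
    congr 1
    ring
  have h5 : expWeight m₁ σ * ((c₂ * H * (expWeight m₂ σ)⁻¹) ^ p * L ^ (-(p - 1)))
      = c₂ ^ p * K ^ (-(p - 1)) * (1 + σ) ^ α * H ^ p := by
    have hpos := expWeight_pos m₂ σ
    rw [← h4, hL, Real.mul_rpow (by positivity) (by positivity), Real.mul_rpow hc₂.le hH,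
      Real.mul_rpow hK0.le (by positivity)]
    ring
  rw [h5]
  have h6 := rpow_neg_abs_mul_rpow_le (b := 5) (by norm_num) hs0 (t := 1 + σ) (by linarith)
    (by linarith) α
  rw [mul_assoc (c₂ ^ p * K ^ (-(p - 1)))]
  gcongr

end Hoelder

section Data

variable {N : ℕ}

lemma expMode_smul (ε : ℝ) (w : L2 N) : expMode (ε • w) = ε * expMode w := by
  rw [expMode, expMode, ← integral_const_mul]
  refine integral_congr_ae ?_
  filter_upwards [Lp.coeFn_smul ε w] with x hx
  rw [hx, Pi.smul_apply, smul_eq_mul, mul_assoc]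

lemma expMode_nonneg (hN : 1 ≤ N) {w : L2 N} (hw : 0 ≤ w) : 0 ≤ expMode w := by
  refine integral_nonneg_of_ae ?_
  filter_upwards [(Lp.coeFn_nonneg w).2 hw] with x hx
  exact mul_nonneg hx (radialExp_pos hN x).le

lemma integrable_mul_radialExp (hN : 1 ≤ N) {R : ℝ} (hR : 0 < R) {w : L2 N}
    (hw : SupportedInBall R w) : Integrable fun x => w x * radialExp N x := by
  obtain ⟨f, hf, hfc, hfe⟩ := exists_cutoff_radialExp (N := N) hN hR
  refine ((Lp.memLp w).integrable_mul (memLp_two_of_compactSupport hf.continuous hfc)).congr ?_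
  filter_upwards [hw] with x hx
  rcases le_or_gt ‖x‖ R with h | h
  · rw [Pi.mul_apply, (hfe x h).eq_of_nhds]
  · rw [Pi.mul_apply, hx h, zero_mul, zero_mul]

lemma expMode_pos (hN : 1 ≤ N) {R : ℝ} (hR : 0 < R) {w : L2 N} (hw : 0 ≤ w)
    (hsupp : SupportedInBall R w) (hne : w ≠ 0) : 0 < expMode w := by
  refine (expMode_nonneg hN hw).lt_of_ne fun h0 => hne ?_
  have hnn : 0 ≤ᵐ[volume] fun x => w x * radialExp N x := by
    filter_upwards [(Lp.coeFn_nonneg w).2 hw] with x hx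
    exact mul_nonneg hx (radialExp_pos hN x).le
  have h1 :=
    (integral_eq_zero_iff_of_nonneg_ae hnn (integrable_mul_radialExp hN hR hsupp)).1 h0.symm
  rw [Lp.eq_zero_iff_ae_eq_zero]
  filter_upwards [h1] with x hx
  exact (mul_eq_zero.1 hx).resolve_right (radialExp_pos hN x).ne'

end Data

section Coupling

variable {N : ℕ}

/-- One of the two integral inequalities: the functional `G = d + ∫₀ᵗ e^{-s} (1+s)^{m₁} ∫ |w|^p φ`
grows at the rate dictated by a lower bound `H` for `∫ w φ`. -/
lemma exists_growth (hN : 1 ≤ N) {p R m₁ m₂ c₂ : ℝ} (hp : 1 < p) (hR : 0 ≤ R) (hc₂ : 0 < c₂) :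
    ∃ c : ℝ, 0 < c ∧ ∀ (T : EReal) (w : ℝ → L2 N) (H : ℝ → ℝ),
      (∀ t ∈ timeInterval T, SupportedInBall (t + R + 1) (w t)) →
      (∀ t ∈ timeInterval T, IntervalIntegrable
        (fun s => expWeight m₁ s * expPowerMode p (w s)) volume 0 t) →
      (∀ t ∈ timeInterval T, ∀ᵐ s ∂(volume.restrict (Ioc 0 t)), expPowerLMode p (w s) < ⊤) →
      (∀ s t : ℝ, 1 ≤ s → s ≤ t → (t : EReal) < T → H s ≤ H t) →
      (∀ s : ℝ, 1 ≤ s → (s : EReal) < T → 0 ≤ H s) →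
      (∀ t ∈ timeInterval T, 1 ≤ t → c₂ * H t ≤ expWeight m₂ t * expMode (w t)) →
      ∀ s t : ℝ, 1 ≤ s → s ≤ t → t ≤ 4 * s → (t : EReal) < T →
        (∫ σ in (0 : ℝ)..s, expWeight m₁ σ * expPowerMode p (w σ)) +
          c * (t - s) * s ^ ((((N : ℝ) - 1) / 2 + m₁) - p * (((N : ℝ) - 1) / 2 + m₂)) * H s ^ p
          ≤ ∫ σ in (0 : ℝ)..t, expWeight m₁ σ * expPowerMode p (w σ) := by
  obtain ⟨c, hc, h⟩ := exists_source_lower_bound (m₁ := m₁) (m₂ := m₂) hN hp hR hc₂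
  refine ⟨c, hc, ?_⟩
  intro T w H hw hint hfin hmono hH0 hVH s t hs hst hts htT
  have ht : t ∈ timeInterval T := ⟨by linarith, htT⟩
  have hsT := EReal.coe_lt_of_le hst htT
  have hsI : s ∈ timeInterval T := ⟨by linarith, hsT⟩
  have hi := hint t ht
  have his := hint s hsI
  have hist := his.symm.trans hi
  rw [← intervalIntegral.integral_add_adjacent_intervals his hist]
  gcongr
  rw [show ∀ A B : ℝ, c * (t - s) * A * B = ∫ _ in s..t, c * A * B by
    intro A B; rw [intervalIntegral.integral_const, smul_eq_mul]; ring]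
  refine intervalIntegral.integral_mono_ae_restrict hst intervalIntegrable_const hist ?_
  have hfin' : ∀ᵐ σ ∂(volume.restrict (Icc s t)), expPowerLMode p (w σ) < ⊤ :=
    ae_restrict_of_ae_restrict_of_subset (show Icc s t ⊆ Ioc 0 t from
      fun σ hσ => ⟨by linarith [hσ.1], hσ.2⟩) (hfin t ht)
  filter_upwards [hfin', ae_restrict_mem measurableSet_Icc] with σ hσfin hσ
  have hσT := EReal.coe_lt_of_le hσ.2 htT
  have hσI : σ ∈ timeInterval T := ⟨by linarith [hσ.1], hσT⟩
  refine h (w σ) σ s (H s) hs hσ.1 (hσ.2.trans hts) (hw σ hσI) hσfin (hH0 s hs hsT) ?_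
  refine le_trans ?_ (hVH σ hσI (hs.trans hσ.1))
  exact mul_le_mul_of_nonneg_left (hmono s σ hs hσ.1 hσT) hc₂.le

/-- Energy solutions give rise to pairs as in `IsBlowupPair`, with constants that do not depend on
the solution. -/
lemma exists_isBlowupPair (hN : 1 ≤ N) {p q μ₁ μ₂ R : ℝ} (hp : 1 < p) (hq : 1 < q)
    (hμ₁ : 0 < μ₁) (hμ₂ : 0 < μ₂) (hR : 0 < R) {f₁ f₂ g₁ g₂ : L2 N}
    (hf₁ : 0 ≤ f₁) (hf₂ : 0 ≤ f₂) (hg₁ : 0 ≤ g₁) (hg₂ : 0 ≤ g₂)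
    (hf₁s : SupportedInBall R f₁) (hf₂s : SupportedInBall R f₂)
    (hg₁s : SupportedInBall R g₁) (hg₂s : SupportedInBall R g₂)
    (h₁ : f₁ ≠ 0 ∨ g₁ ≠ 0) (h₂ : f₂ ≠ 0 ∨ g₂ ≠ 0) :
    ∃ c d : ℝ, 0 < c ∧ 0 < d ∧ ∀ ε : ℝ, 0 < ε → ∀ (T : EReal) (u v : ℝ → L2 N),
      IsEnergySolution μ₁ μ₂ p q (ε • f₁) (ε • g₁) (ε • f₂) (ε • g₂) T u v →
      SupportedInCone T R u → SupportedInCone T R v →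
      ∃ G H : ℝ → ℝ, IsBlowupPair T c
        ((((N : ℝ) - 1) / 2 + μ₁ / 2) - p * (((N : ℝ) - 1) / 2 + μ₂ / 2))
        ((((N : ℝ) - 1) / 2 + μ₂ / 2) - q * (((N : ℝ) - 1) / 2 + μ₁ / 2)) p q (d * ε) G H := by
  have hdata : ∀ f g : L2 N, 0 ≤ f → 0 ≤ g → SupportedInBall R f → SupportedInBall R g →
      (f ≠ 0 ∨ g ≠ 0) → 0 < expMode g + expMode f := by
    intro f g hf hg hfs hgs hne
    rcases hne with h | h
    · linarith [expMode_pos hN hR hf hfs h, expMode_nonneg hN hg]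
    · linarith [expMode_pos hN hR hg hgs h, expMode_nonneg hN hf]
  set D₁ := expMode g₁ + expMode f₁ with hD₁
  set D₂ := expMode g₂ + expMode f₂ with hD₂
  have hD₁0 : 0 < D₁ := hdata f₁ g₁ hf₁ hg₁ hf₁s hg₁s h₁
  have hD₂0 : 0 < D₂ := hdata f₂ g₂ hf₂ hg₂ hf₂s hg₂s h₂
  obtain ⟨k₁, hk₁, hlow₁⟩ := exists_lower_bound_dampedMode hμ₁.le
  obtain ⟨k₂, hk₂, hlow₂⟩ := exists_lower_bound_dampedMode hμ₂.le
  obtain ⟨c₁, hc₁, hgrow₁⟩ :=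
    exists_growth (N := N) (m₁ := μ₁ / 2) (m₂ := μ₂ / 2) hN hp hR.le hk₂
  obtain ⟨c₂, hc₂, hgrow₂⟩ :=
    exists_growth (N := N) (m₁ := μ₂ / 2) (m₂ := μ₁ / 2) hN hq hR.le hk₁
  refine ⟨min c₁ c₂, min D₁ D₂, lt_min hc₁ hc₂, lt_min hD₁0 hD₂0, ?_⟩
  intro ε hε T u v hsol hu hv
  obtain ⟨hT, ut, vt, Du, Dv, hcu, hcv, -, -, hu0, hut0, hv0, hvt0, hwu, hwv⟩ := hsol
  have hutS : ∀ t ∈ timeInterval T, SupportedInBall (t + R + 1) (ut t) := fun t ht =>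
    hu.deriv hT ht (hcu.hasDeriv t ht)
  have hvtS : ∀ t ∈ timeInterval T, SupportedInBall (t + R + 1) (vt t) := fun t ht =>
    hv.deriv hT ht (hcv.hasDeriv t ht)
  obtain ⟨hm₁, hfin₁⟩ := isDampedMode_of_weakForm hN hT (by linarith) hcu hu
    hcv.continuousOn_deriv hvtS hwu
  obtain ⟨hm₂, hfin₂⟩ := isDampedMode_of_weakForm hN hT (by linarith) hcv hv
    hcu.continuousOn_deriv hutS hwv
  have hV₁ := hlow₁ T _ _ _ hm₁
    (by rw [hu0, expMode_smul]; exact mul_nonneg hε.le (expMode_nonneg hN hf₁))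
    (by rw [hut0, expMode_smul]; exact mul_nonneg hε.le (expMode_nonneg hN hg₁))
  have hV₂ := hlow₂ T _ _ _ hm₂
    (by rw [hv0, expMode_smul]; exact mul_nonneg hε.le (expMode_nonneg hN hf₂))
    (by rw [hvt0, expMode_smul]; exact mul_nonneg hε.le (expMode_nonneg hN hg₂))
  simp only [hu0, hut0, expMode_smul, ← mul_add, ← hD₁] at hV₁
  simp only [hv0, hvt0, expMode_smul, ← mul_add, ← hD₂] at hV₂
  have hint : ∀ (m r : ℝ) (w : ℝ → L2 N), (∀ t ∈ timeInterval T,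
      IntervalIntegrable (fun s => expPowerMode r (w s)) volume 0 t) → ∀ t ∈ timeInterval T,
      IntervalIntegrable (fun s => expWeight m s * expPowerMode r (w s)) volume 0 t := by
    intro m r w h t ht
    exact (h t ht).continuousOn_mul (by rw [uIcc_of_le ht.1]; exact continuousOn_expWeight m t)
  have hnn : ∀ (m r : ℝ) (w : L2 N) (s : ℝ), 0 ≤ expWeight m s * expPowerMode r w :=
    fun m r w s => mul_nonneg (expWeight_pos m s).le (integral_nonneg fun x =>
      mul_nonneg (Real.rpow_nonneg (abs_nonneg _) _) (radialExp_pos hN x).le)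
  have hmono : ∀ (m r D : ℝ) (w : ℝ → L2 N), (∀ t ∈ timeInterval T,
      IntervalIntegrable (fun s => expPowerMode r (w s)) volume 0 t) →
      ∀ s t : ℝ, 1 ≤ s → s ≤ t → (t : EReal) < T →
        D + ∫ σ in (0 : ℝ)..s, expWeight m σ * expPowerMode r (w σ)
          ≤ D + ∫ σ in (0 : ℝ)..t, expWeight m σ * expPowerMode r (w σ) := by
    intro m r D w h s t hs hst htT
    gcongr
    exact intervalIntegral.integral_mono_interval le_rfl (by linarith) hst
      (ae_of_all _ fun σ => hnn m r (w σ) σ) (hint m r w h t ⟨by linarith, htT⟩)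
  have hle : ∀ (m r D : ℝ) (w : ℝ → L2 N) (s : ℝ), 1 ≤ s →
      D ≤ D + ∫ σ in (0 : ℝ)..s, expWeight m σ * expPowerMode r (w σ) := fun m r D w s hs =>
    le_add_of_nonneg_right (intervalIntegral.integral_nonneg (by linarith)
      fun σ _ => hnn m r (w σ) σ)
  set G : ℝ → ℝ := fun t =>
    ε * D₁ + ∫ σ in (0 : ℝ)..t, expWeight (μ₁ / 2) σ * expPowerMode p (vt σ) with hG
  set H : ℝ → ℝ := fun t =>
    ε * D₂ + ∫ σ in (0 : ℝ)..t, expWeight (μ₂ / 2) σ * expPowerMode q (ut σ) with hH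
  have hG0 : ∀ s : ℝ, 1 ≤ s → (s : EReal) < T → 0 ≤ G s := fun s hs _ =>
    le_trans (by positivity) (hle (μ₁ / 2) p (ε * D₁) vt s hs)
  have hH0 : ∀ s : ℝ, 1 ≤ s → (s : EReal) < T → 0 ≤ H s := fun s hs _ =>
    le_trans (by positivity) (hle (μ₂ / 2) q (ε * D₂) ut s hs)
  have hGm := hmono (μ₁ / 2) p (ε * D₁) vt hm₁.source_integrable
  have hHm := hmono (μ₂ / 2) q (ε * D₂) ut hm₂.source_integrable
  have hg₁' := hgrow₁ T vt H hvtS (hint (μ₁ / 2) p vt hm₁.source_integrable) hfin₁ hHm hH0 hV₂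
  have hg₂' := hgrow₂ T ut G hutS (hint (μ₂ / 2) q ut hm₂.source_integrable) hfin₂ hGm hG0 hV₁
  refine ⟨G, H, hGm, hHm, ?_, ?_, ?_, ?_⟩
  · intro s hs _
    refine le_trans ?_ (hle (μ₁ / 2) p (ε * D₁) vt s hs)
    rw [mul_comm ε]; gcongr; exact min_le_left _ _
  · intro s hs _
    refine le_trans ?_ (hle (μ₂ / 2) q (ε * D₂) ut s hs)
    rw [mul_comm ε]; gcongr; exact min_le_right _ _
  · intro s t hs hst hts htT
    have h1 := hg₁' s t hs hst hts htT
    have h2 := Real.rpow_nonneg (hH0 s hs (EReal.coe_lt_of_le hst htT)) p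
    have h3 : min c₁ c₂ * (t - s) * s ^ ((((N : ℝ) - 1) / 2 + μ₁ / 2)
        - p * (((N : ℝ) - 1) / 2 + μ₂ / 2)) * H s ^ p ≤ c₁ * (t - s) * s ^ ((((N : ℝ) - 1) / 2
        + μ₁ / 2) - p * (((N : ℝ) - 1) / 2 + μ₂ / 2)) * H s ^ p := by
      have : 0 ≤ t - s := by linarith
      gcongr
      exact min_le_left _ _
    simp only [hG]
    linarith
  · intro s t hs hst hts htT
    have h1 := hg₂' s t hs hst hts htT
    have h2 := Real.rpow_nonneg (hG0 s hs (EReal.coe_lt_of_le hst htT)) q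
    have h3 : min c₁ c₂ * (t - s) * s ^ ((((N : ℝ) - 1) / 2 + μ₂ / 2)
        - q * (((N : ℝ) - 1) / 2 + μ₁ / 2)) * G s ^ q ≤ c₂ * (t - s) * s ^ ((((N : ℝ) - 1) / 2
        + μ₂ / 2) - q * (((N : ℝ) - 1) / 2 + μ₁ / 2)) * G s ^ q := by
      have : 0 ≤ t - s := by linarith
      gcongr
      exact min_le_right _ _
    simp only [hH]
    linarith

end Coupling

/-! ### Lifespan bounds -/

/-- Lifespan bounds for blow-up pairs in terms of `δ = d ε` become bounds in terms of `ε`. -/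
lemma exists_bound_rescale {κ d : ℝ} (hd : 0 < d) {F : ℝ → ℝ} {P : ℝ → EReal → Prop}
    (h : ∃ δ₀ : ℝ, 0 < δ₀ ∧ ∃ C : ℝ, 0 < C ∧ ∀ δ : ℝ, 0 < δ → δ ≤ δ₀ → ∀ T : EReal, P δ T →
      T ≤ ((F (C * δ ^ (-κ)) : ℝ) : EReal)) :
    ∃ ε₀ : ℝ, 0 < ε₀ ∧ ∃ C : ℝ, 0 < C ∧ ∀ ε : ℝ, 0 < ε → ε ≤ ε₀ → ∀ T : EReal, P (d * ε) T →
      T ≤ ((F (C * ε ^ (-κ)) : ℝ) : EReal) := by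
  obtain ⟨δ₀, hδ₀, C, hC, h⟩ := h
  refine ⟨δ₀ / d, by positivity, C * d ^ (-κ), by positivity, fun ε hε hε₀ T hP => ?_⟩
  rw [le_div_iff₀ hd] at hε₀
  have := h (d * ε) (by positivity) (by linarith) T hP
  rwa [Real.mul_rpow hd.le hε.le, ← mul_assoc] at this

theorem theorem2p1 (N : ℕ) (hN : 1 ≤ N) (p q μ₁ μ₂ R : ℝ) (hp : 1 < p) (hq : 1 < q)
    (hμ₁ : 0 < μ₁) (hμ₂ : 0 < μ₂) (hR : 0 < R) (hΩ : 0 ≤ Omeg N μ₁ μ₂ p q)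
    (f₁ f₂ g₁ g₂ : L2 N) (hf₁ : MemH1 f₁) (hf₂ : MemH1 f₂)
    (hf₁_nonneg : 0 ≤ f₁) (hf₂_nonneg : 0 ≤ f₂) (hg₁_nonneg : 0 ≤ g₁) (hg₂_nonneg : 0 ≤ g₂)
    (hf₁_supp : SupportedInBall R f₁) (hf₂_supp : SupportedInBall R f₂)
    (hg₁_supp : SupportedInBall R g₁) (hg₂_supp : SupportedInBall R g₂)
    (h₁_ne : f₁ ≠ 0 ∨ g₁ ≠ 0) (h₂_ne : f₂ ≠ 0 ∨ g₂ ≠ 0) :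
    ∃ ε₀ : ℝ, 0 < ε₀ ∧ ∃ C : ℝ, 0 < C ∧ ∀ ε : ℝ, 0 < ε → ε ≤ ε₀ →
      ∀ (T : EReal) (u v : ℝ → L2 N),
        IsEnergySolution μ₁ μ₂ p q (ε • f₁) (ε • g₁) (ε • f₂) (ε • g₂) T u v →
        SupportedInCone T R u → SupportedInCone T R v →
        (0 < Omeg N μ₁ μ₂ p q →
          T ≤ ((C * ε ^ (-(1 / Omeg N μ₁ μ₂ p q)) : ℝ) : EReal)) ∧
        (Omeg N μ₁ μ₂ p q = 0 →
          T ≤ ((Real.exp (C * ε ^ (-(p * q - 1))) : ℝ) : EReal)) ∧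
        (Lam (N + μ₁) p q = 0 ∧ Lam (N + μ₂) q p = 0 →
          T ≤ ((Real.exp (C * ε ^ (-(min ((p * q - 1) / (p + 1)) ((p * q - 1) / (q + 1)))))
            : ℝ) : EReal)) := by
  obtain ⟨c, d, hc, hd, hpair⟩ := exists_isBlowupPair hN hp hq hμ₁ hμ₂ hR hf₁_nonneg hf₂_nonneg
    hg₁_nonneg hg₂_nonneg hf₁_supp hf₂_supp hg₁_supp hg₂_supp h₁_ne h₂_ne
  set α : ℝ := (((N : ℝ) - 1) / 2 + μ₁ / 2) - p * (((N : ℝ) - 1) / 2 + μ₂ / 2) with hα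
  set β : ℝ := (((N : ℝ) - 1) / 2 + μ₂ / 2) - q * (((N : ℝ) - 1) / 2 + μ₁ / 2) with hβ
  have hpq : 0 < p * q - 1 := by nlinarith
  -- The two scaling exponents of the system of integral inequalities.
  have hl₁ : p + 1 + (α + p * β) = (p * q - 1) * Lam (N + μ₁) p q := by
    rw [Lam, hα, hβ]; field_simp; ring
  have hl₂ : q + 1 + (β + q * α) = (p * q - 1) * Lam (N + μ₂) q p := by
    have hqp : q * p - 1 ≠ 0 := by rw [mul_comm]; exact hpq.ne'
    rw [Lam, hα, hβ, mul_comm p q]; field_simp; ring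
  set l₁ := Lam (N + μ₁) p q with hl₁d
  set l₂ := Lam (N + μ₂) q p with hl₂d
  have hOm : Omeg N μ₁ μ₂ p q = max l₁ l₂ := rfl
  -- Whether a pair exists, with either component in the first place.
  set P₁ : ℝ → EReal → Prop := fun δ T => ∃ G H, IsBlowupPair T c α β p q δ G H with hP₁
  set P₂ : ℝ → EReal → Prop := fun δ T => ∃ G H, IsBlowupPair T c β α q p δ G H with hP₂
  have hP₂' : ∀ ε : ℝ, 0 < ε → ∀ (T : EReal) (u v : ℝ → L2 N),
      IsEnergySolution μ₁ μ₂ p q (ε • f₁) (ε • g₁) (ε • f₂) (ε • g₂) T u v →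
      SupportedInCone T R u → SupportedInCone T R v → P₂ (d * ε) T := by
    intro ε hε T u v h hu hv
    obtain ⟨G, H, hGH⟩ := hpair ε hε T u v h hu hv
    exact ⟨H, G, hGH.symm⟩
  have sub₁ : 0 < l₁ → ∃ ε₀ : ℝ, 0 < ε₀ ∧ ∃ C : ℝ, 0 < C ∧ ∀ ε : ℝ, 0 < ε → ε ≤ ε₀ →
      ∀ T : EReal, P₁ (d * ε) T → T ≤ ((C * ε ^ (-(1 / l₁)) : ℝ) : EReal) := by
    intro hl
    obtain ⟨δ₀, hδ₀, C, hC, h⟩ := IsBlowupPair.lifespan_subcritical (α := α) (β := β) hc hp hq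
      (by rw [hl₁]; positivity)
    refine exists_bound_rescale (F := fun y => y) hd ⟨δ₀, hδ₀, C, hC, ?_⟩
    rintro δ hδ hδ₀' T ⟨G, H, hGH⟩
    have := h δ hδ hδ₀' T G H hGH
    rwa [hl₁, show (p * q - 1) / ((p * q - 1) * l₁) = 1 / l₁ by field_simp] at this
  have sub₂ : 0 < l₂ → ∃ ε₀ : ℝ, 0 < ε₀ ∧ ∃ C : ℝ, 0 < C ∧ ∀ ε : ℝ, 0 < ε → ε ≤ ε₀ →
      ∀ T : EReal, P₂ (d * ε) T → T ≤ ((C * ε ^ (-(1 / l₂)) : ℝ) : EReal) := by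
    intro hl
    obtain ⟨δ₀, hδ₀, C, hC, h⟩ := IsBlowupPair.lifespan_subcritical (α := β) (β := α) hc hq hp
      (by rw [hl₂]; positivity)
    refine exists_bound_rescale (F := fun y => y) hd ⟨δ₀, hδ₀, C, hC, ?_⟩
    rintro δ hδ hδ₀' T ⟨G, H, hGH⟩
    have := h δ hδ hδ₀' T G H hGH
    rwa [hl₂, mul_comm q p, show (p * q - 1) / ((p * q - 1) * l₂) = 1 / l₂ by field_simp] at this
  have crit₁ : l₁ = 0 → ∃ ε₀ : ℝ, 0 < ε₀ ∧ ∃ C : ℝ, 0 < C ∧ ∀ ε : ℝ, 0 < ε → ε ≤ ε₀ →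
      ∀ T : EReal, P₁ (d * ε) T → T ≤ ((Real.exp (C * ε ^ (-(p * q - 1))) : ℝ) : EReal) := by
    intro hl
    obtain ⟨δ₀, hδ₀, C, hC, h⟩ := IsBlowupPair.lifespan_critical (α := α) (β := β) hc hp hq
      (by rw [hl₁, hl, mul_zero])
    refine exists_bound_rescale (F := Real.exp) hd ⟨δ₀, hδ₀, C, hC, ?_⟩
    rintro δ hδ hδ₀' T ⟨G, H, hGH⟩
    exact h δ hδ hδ₀' T G H hGH
  have crit₂ : l₂ = 0 → ∃ ε₀ : ℝ, 0 < ε₀ ∧ ∃ C : ℝ, 0 < C ∧ ∀ ε : ℝ, 0 < ε → ε ≤ ε₀ →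
      ∀ T : EReal, P₂ (d * ε) T → T ≤ ((Real.exp (C * ε ^ (-(p * q - 1))) : ℝ) : EReal) := by
    intro hl
    obtain ⟨δ₀, hδ₀, C, hC, h⟩ := IsBlowupPair.lifespan_critical (α := β) (β := α) hc hq hp
      (by rw [hl₂, hl, mul_zero])
    refine exists_bound_rescale (F := Real.exp) hd ⟨δ₀, hδ₀, C, hC, ?_⟩
    rintro δ hδ hδ₀' T ⟨G, H, hGH⟩
    have := h δ hδ hδ₀' T G H hGH
    rwa [mul_comm q p] at this
  by_cases hpos : 0 < max l₁ l₂
  · -- Subcritical case: the other two claims are vacuous.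
    have hvac : ¬(l₁ = 0 ∧ l₂ = 0) := by
      rintro ⟨h1, h2⟩; rw [h1, h2, max_self] at hpos; exact lt_irrefl _ hpos
    rw [hOm]
    rcases le_total l₂ l₁ with hle | hle
    · rw [max_eq_left hle] at hpos ⊢
      obtain ⟨ε₀, hε₀, C, hC, h⟩ := sub₁ hpos
      exact ⟨ε₀, hε₀, C, hC, fun ε hε hεε T u v hs hu hv =>
        ⟨fun _ => h ε hε hεε T (hpair ε hε T u v hs hu hv), fun h0 => absurd h0 hpos.ne',
          fun h0 => absurd h0 hvac⟩⟩
    · rw [max_eq_right hle] at hpos ⊢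
      obtain ⟨ε₀, hε₀, C, hC, h⟩ := sub₂ hpos
      exact ⟨ε₀, hε₀, C, hC, fun ε hε hεε T u v hs hu hv =>
        ⟨fun _ => h ε hε hεε T (hP₂' ε hε T u v hs hu hv), fun h0 => absurd h0 hpos.ne',
          fun h0 => absurd h0 hvac⟩⟩
  · rw [hOm] at hΩ ⊢
    have hzero : max l₁ l₂ = 0 := le_antisymm (not_lt.1 hpos) hΩ
    have hcrit : ∃ ε₀ : ℝ, 0 < ε₀ ∧ ∃ C : ℝ, 0 < C ∧ ∀ ε : ℝ, 0 < ε → ε ≤ ε₀ →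
        ∀ (T : EReal), P₁ (d * ε) T → P₂ (d * ε) T →
          T ≤ ((Real.exp (C * ε ^ (-(p * q - 1))) : ℝ) : EReal) := by
      rcases le_total l₂ l₁ with hle | hle
      · rw [max_eq_left hle] at hzero
        obtain ⟨ε₀, hε₀, C, hC, h⟩ := crit₁ hzero
        exact ⟨ε₀, hε₀, C, hC, fun ε hε hεε T h1 _ => h ε hε hεε T h1⟩
      · rw [max_eq_right hle] at hzero
        obtain ⟨ε₀, hε₀, C, hC, h⟩ := crit₂ hzero
        exact ⟨ε₀, hε₀, C, hC, fun ε hε hεε T _ h2 => h ε hε hεε T h2⟩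
    have hdbl : ∃ ε₀ : ℝ, 0 < ε₀ ∧ ∃ C : ℝ, 0 < C ∧ ∀ ε : ℝ, 0 < ε → ε ≤ ε₀ →
        ∀ (T : EReal), P₁ (d * ε) T → P₂ (d * ε) T → l₁ = 0 ∧ l₂ = 0 →
          T ≤ ((Real.exp (C * ε ^ (-(min ((p * q - 1) / (p + 1)) ((p * q - 1) / (q + 1)))))
            : ℝ) : EReal) := by
      by_cases h00 : l₁ = 0 ∧ l₂ = 0
      · -- Both weights are `1/t` when both scaling exponents vanish.
        rw [h00.1, mul_zero] at hl₁
        rw [h00.2, mul_zero] at hl₂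
        have hα1 : α = -1 := by
          have : (p * q - 1) * (α + 1) = 0 := by linear_combination p * hl₂ - hl₁
          linarith [(mul_eq_zero.1 this).resolve_left hpq.ne']
        have hβ1 : β = -1 := by
          have : (p * q - 1) * (β + 1) = 0 := by linear_combination q * hl₁ - hl₂
          linarith [(mul_eq_zero.1 this).resolve_left hpq.ne']
        rcases le_total ((p * q - 1) / (p + 1)) ((p * q - 1) / (q + 1)) with hle | hle
        · rw [min_eq_left hle]
          obtain ⟨δ₀, hδ₀, C, hC, h⟩ := IsBlowupPair.lifespan_doubly_critical hc hp hq hα1 hβ1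
          obtain ⟨ε₀, hε₀, C', hC', h'⟩ := exists_bound_rescale (F := Real.exp) (P := P₁) hd
            ⟨δ₀, hδ₀, C, hC, fun δ hδ hδ₀' T ⟨G, H, hGH⟩ => h δ hδ hδ₀' T G H hGH⟩
          exact ⟨ε₀, hε₀, C', hC', fun ε hε hεε T h1 _ _ => h' ε hε hεε T h1⟩
        · rw [min_eq_right hle]
          obtain ⟨δ₀, hδ₀, C, hC, h⟩ := IsBlowupPair.lifespan_doubly_critical hc hq hp hβ1 hα1
          rw [mul_comm q p] at h
          obtain ⟨ε₀, hε₀, C', hC', h'⟩ := exists_bound_rescale (F := Real.exp) (P := P₂) hd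
            ⟨δ₀, hδ₀, C, hC, fun δ hδ hδ₀' T ⟨G, H, hGH⟩ => h δ hδ hδ₀' T G H hGH⟩
          exact ⟨ε₀, hε₀, C', hC', fun ε hε hεε T _ h2 _ => h' ε hε hεε T h2⟩
      · exact ⟨1, one_pos, 1, one_pos, fun _ _ _ _ _ _ h0 => absurd h0 h00⟩
    obtain ⟨ε₀, hε₀, C, hC, h⟩ := hcrit
    obtain ⟨ε₁, hε₁, C', hC', h'⟩ := hdbl
    refine ⟨min ε₀ ε₁, lt_min hε₀ hε₁, max C C', lt_max_of_lt_left hC, ?_⟩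
    intro ε hε hεε T u v hs hu hv
    have h1 : P₁ (d * ε) T := hpair ε hε T u v hs hu hv
    have h2 := hP₂' ε hε T u v hs hu hv
    refine ⟨fun h0 => absurd h0 hpos, fun _ => ?_, fun h0 => ?_⟩
    · refine (h ε hε (hεε.trans (min_le_left _ _)) T h1 h2).trans (EReal.coe_le_coe_iff.2 ?_)
      have : 0 ≤ ε ^ (-(p * q - 1)) := by positivity
      gcongr
      exact le_max_left _ _
    · refine (h' ε hε (hεε.trans (min_le_right _ _)) T h1 h2 h0).trans (EReal.coe_le_coe_iff.2 ?_)
      gcongr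
      exact le_max_right _ _
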